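/- Fix $q\in(0,1)$, $\zeta_+>0$, $\zeta_-<0$ and an integer $N\ge 1$. Let $\mathbb L=\{\zeta_+q^n:n\in\mathbb Z\}\cup\{\zeta_-q^n:n\in\mathbb Z\}$ and $\overline{\mathbb L}=\mathbb L\cup\{0\}$. Let $\mathbb G_N$ be the set of configurations $X=(x_1<\dots<x_N)$ of $N$ points of $\mathbb L$, and let $\overline{\mathbb G}_N$ be its closure in $\mathbb R^N$. For $a<b$ in $\mathbb L$ put $I(a,b)=[a,b)\cap\mathbb L$ if $b<0$, $I(a,b)=[a,b]\cap\mathbb L$ if $a<0<b$, and $I(a,b)=(a,b]\cap\mathbb L$ if $a>0$. For $X\in\mathbb G_{M+1}$, $Y\in\mathbb G_M$ ($M\ge1$) set $$\Lambda^{M+1}_M(X,Y)=(q;q)_M\,\prod_{i=1}^M|y_i|\;\frac{\prod_{1\le i<j\le M}(y_j-y_i)}{\prod_{1\le i<j\le M+1}(x_j-x_i)}$$ if $y_i\in I(x_i,x_{i+1})$ for all $i=1,\dots,M$, and $\Lambda^{M+1}_M(X,Y)=0$ otherwise, where $(q;q)_M=\prod_{i=1}^M(1-q^i)$. Let $\Lambda^N_1=\Lambda^N_{N-1}\cdots\Lambda^2_1$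 be the matrix product ($\Lambda^1_1$ is the identity), a matrix of format $\mathbb G_N\times\mathbb L$. Put $[n]_q=(1-q^n)/(1-q)$ and $[m]_q!=[1]_q\cdots[m]_q$; let $h_m$ be the complete homogeneous symmetric polynomial of degree $m$. For a function $f$ (real- or complex-valued) on $\overline{\mathbb L}$ put $D_qf(t)=\dfrac{f(t)-f(tq)}{t(1-q)}$ for $t\in\mathbb L$, and $D_q^\ell f(0)=\lim_{t\to0,\,t\in\mathbb L}D_q^\ell f(t)$ when this limit exists ($\ell\ge1$). The class $C^n(\mathbb L)$ consists of the functions $f$ on $\overline{\mathbb L}$ that are continuous at $0$ and for which $D_q^\ell f(0)$ exists for all $\ell=1,\dots,n$. Divided differences are defined by $f[x_1]=f(x_1)$ and $f[x_1,\dots,x_N]=\dfrac{f[x_2,\dots,x_N]-f[x_1,\dots,x_{N-1}]}{x_N-x_1}$. **Theorem.** The rows $\Lambda^N_1(X,\cdot)$, $X\in\mathbb G_N$, are probability measures on $\mathbb L$, and the map $X\mapsto\Lambda^N_1(X,\cdot)$ extends in a unique way to a map from $\overline{\mathbb G}_N$ to the set of probability measures on $\overline{\mathbb L}$ that is continuous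 in the weak topology; the extension is denoted by the same symbol. Moreover: (i) For every $X\in\overline{\mathbb G}_N$ there exists a unique probability measure $B^q_N(X)$ on $\overline{\mathbb L}$ with the moments $$\int t^m\,B^q_N(X)(dt)=\frac{[m]_q!\,[N-1]_q!}{[m+N-1]_q!}\,h_m(X),\qquad m=0,1,2,\dots .$$ Its support is contained in the smallest closed segment containing all points of $X$, and $B^q_N(X)=\Lambda^N_1(X,\cdot)$. (ii) If $X=(x_1,\dots,x_N)\in\mathbb G_N$ and $f\in C^{N-1}(\mathbb L)$, then $D_q^{N-1}f$ is integrable with respect to $B^q_N(X)$ and $$f[x_1,\dots,x_N]=\frac1{[N-1]_q!}\int D_q^{N-1}f(t)\,B^q_N(X)(dt).$$ -/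

import Mathlib

open MeasureTheory Filter Topology
open scoped ENNReal

namespace QBSpline

/-! ### The two-sided `q`-lattice -/

/-- The two-sided `q`-lattice `L = {ζ₊ qⁿ} ∪ {ζ₋ qⁿ}`, `n ∈ ℤ`. -/
def lattice (q ζp ζm : ℝ) : Set ℝ :=
  {t | ∃ n : ℤ, t = ζp * q ^ n} ∪ {t | ∃ n : ℤ, t = ζm * q ^ n}

/-- The closed lattice `L ∪ {0}`. -/
def closedLattice (q ζp ζm : ℝ) : Set ℝ := lattice q ζp ζm ∪ {0}

/-- The intervals of the lattice: `[a, b) ∩ L` if `a < b < 0`, `(a, b] ∩ L` if `0 < a < b`, and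
`[a, b] ∩ L` if `a < 0 < b`. -/
def latticeInterval (q ζp ζm a b : ℝ) : Set ℝ :=
  {y | y ∈ lattice q ζp ζm ∧
    ((b < 0 ∧ a ≤ y ∧ y < b) ∨ (a < 0 ∧ 0 < b ∧ a ≤ y ∧ y ≤ b) ∨ (0 < a ∧ a < y ∧ y ≤ b))}

/-- `G_N`: the configurations `x₁ < ⋯ < x_N` of `N` points of the lattice. -/
def level (q ζp ζm : ℝ) (N : ℕ) : Set (Fin N → ℝ) :=
  {X | StrictMono X ∧ ∀ i, X i ∈ lattice q ζp ζm}

/-- The closure of `G_N` (in `ℝ^N`, equivalently in the closed cone `x₁ ≤ ⋯ ≤ x_N`). -/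
def closedLevel (q ζp ζm : ℝ) (N : ℕ) : Set (Fin N → ℝ) := closure (level q ζp ζm N)

/-- The inclusion of `G_N` into its closure. -/
def levelIncl {q ζp ζm : ℝ} {N : ℕ} (X : level q ζp ζm N) : closedLevel q ζp ζm N :=
  ⟨X.1, subset_closure X.2⟩

/-- The points of a configuration of `G_N`, as points of the closed lattice. -/
def knots {q ζp ζm : ℝ} {N : ℕ} (X : level q ζp ζm N) (i : Fin N) : closedLattice q ζp ζm :=
  ⟨X.1 i, Or.inl (X.2.2 i)⟩

/-! ### The stochastic matrices -/

/-- The `q`-Pochhammer symbol `(a; q)_N`. -/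
noncomputable def qPochhammer (a q : ℝ) (N : ℕ) : ℝ := ∏ i ∈ Finset.range N, (1 - a * q ^ i)

/-- `V(a₁, …, a_M) = ∏_{i < j} (a_i - a_j)`. -/
noncomputable def vandermonde {M : ℕ} (A : Fin M → ℝ) : ℝ :=
  ∏ i, ∏ j ∈ Finset.Ioi i, (A i - A j)

/-- `Y ≺ X`: `y_i ∈ I(x_i, x_{i+1})` for all `i`. -/
def Interlace (q ζp ζm : ℝ) {N : ℕ} (X : Fin (N + 1) → ℝ) (Y : Fin N → ℝ) : Prop :=
  ∀ i : Fin N, Y i ∈ latticeInterval q ζp ζm (X i.castSucc) (X i.succ)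

open Classical in
/-- The matrix entry `Λ^{N+1}_N(X, Y)`. -/
noncomputable def linkEntry (q ζp ζm : ℝ) {N : ℕ} (X : Fin (N + 1) → ℝ) (Y : Fin N → ℝ) : ℝ :=
  if Interlace q ζp ζm X Y then
    qPochhammer q q N * (∏ i, |Y i|) * (|vandermonde Y| / |vandermonde X|)
  else 0

open Classical in
/-- The matrix `Λ^N_1 = Λ^N_{N-1} ⋯ Λ^2_1` of format `G_N × G_1` (all the entries are nonnegative);
`Λ^1_1` is the identity matrix, and the value at `N = 0` is a dummy. -/
noncomputable def linkToOne (q ζp ζm : ℝ) :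
    (N : ℕ) → level q ζp ζm N → level q ζp ζm 1 → ℝ≥0∞
  | 0 => fun _ _ => 0
  | 1 => fun X Z => if X = Z then 1 else 0
  | N + 2 => fun X Z =>
      ∑' Y : level q ζp ζm (N + 1),
        ENNReal.ofReal (linkEntry q ζp ζm X.1 Y.1) * linkToOne q ζp ζm (N + 1) Y Z

/-- The row `Λ^N_1(X, ·)`, `X ∈ G_N`, as a measure on the closed lattice (it is carried by
`G_1 = L`). -/
noncomputable def linkMeasure {q ζp ζm : ℝ} {N : ℕ} (X : level q ζp ζm N) :
    Measure (closedLattice q ζp ζm) :=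
  Measure.sum fun Z : level q ζp ζm 1 => linkToOne q ζp ζm N X Z • Measure.dirac (knots Z 0)

/-- `Λ` is an extension of `Λ^N_1 : G_N → P(L)` to a map from the closure of `G_N` to the
probability measures on the closed lattice that is continuous for the weak topology. -/
def IsExtendedLink {q ζp ζm : ℝ} {N : ℕ}
    (Λ : closedLevel q ζp ζm N → ProbabilityMeasure (closedLattice q ζp ζm)) : Prop :=
  Continuous Λ ∧
    ∀ X : level q ζp ζm N,
      (Λ (levelIncl X) : Measure (closedLattice q ζp ζm)) = linkMeasure X

/-! ### Moments -/

/-- `[n]_q = (1 - qⁿ) / (1 - q)`. -/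
noncomputable def qNumber (q : ℝ) (n : ℕ) : ℝ := (1 - q ^ n) / (1 - q)

/-- `[m]_q! = [1]_q ⋯ [m]_q`. -/
noncomputable def qFactorial (q : ℝ) (m : ℕ) : ℝ := ∏ i ∈ Finset.range m, qNumber q (i + 1)

/-- The complete homogeneous symmetric polynomial `h_m(x₁, …, x_N)`. -/
noncomputable def completeHom (m : ℕ) {N : ℕ} (X : Fin N → ℝ) : ℝ :=
  MvPolynomial.eval X (MvPolynomial.hsymm (Fin N) ℝ m)

/-- The measure `ν` on the closed lattice has all moments, and they are
`[m]_q! [N-1]_q! / [m+N-1]_q! · h_m(X)`, `m = 0, 1, 2, …` (for `N ≥ 1`). -/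
def HasSplineMoments {q ζp ζm : ℝ} {N : ℕ} (X : Fin N → ℝ)
    (ν : Measure (closedLattice q ζp ζm)) : Prop :=
  ∀ m : ℕ, Integrable (fun t : closedLattice q ζp ζm => (t : ℝ) ^ m) ν ∧
    ∫ t : closedLattice q ζp ζm, (t : ℝ) ^ m ∂ν =
      qFactorial q m * qFactorial q (N - 1) / qFactorial q (m + N - 1) * completeHom m X

/-! ### Divided differences and the `q`-derivative -/

section Functions

variable {q ζp ζm : ℝ} {𝕜 : Type} [RCLike 𝕜]

/-- The divided difference `f[x₁, …, x_N]` of a function on the closed lattice, for `N ≥ 1` pairwise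
distinct knots: `f[x₁] = f(x₁)` and
`f[x₁, …, x_N] = (f[x₂, …, x_N] - f[x₁, …, x_{N-1}]) / (x_N - x₁)`. The value at `N = 0` is a
dummy. -/
noncomputable def dividedDifference (f : closedLattice q ζp ζm → 𝕜) :
    (N : ℕ) → (Fin N → closedLattice q ζp ζm) → 𝕜
  | 0, _ => 0
  | 1, x => f (x 0)
  | N + 2, x =>
      (dividedDifference f (N + 1) (Fin.tail x) - dividedDifference f (N + 1) (Fin.init x)) /
        ((((x (Fin.last (N + 1)) : ℝ) - (x 0 : ℝ) : ℝ)) : 𝕜)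

/-- The point `0` of the closed lattice. -/
def origin (q ζp ζm : ℝ) : closedLattice q ζp ζm := ⟨0, Or.inr rfl⟩

theorem mul_mem_closedLattice {t : ℝ} (ht : t ∈ closedLattice q ζp ζm) :
    t * q ∈ closedLattice q ζp ζm := by
  rcases eq_or_ne q 0 with h0 | h0
  · right
    simp [h0]
  rcases ht with (⟨n, rfl⟩ | ⟨n, rfl⟩) | rfl
  · exact Or.inl (Or.inl ⟨n + 1, by rw [zpow_add_one₀ h0, mul_assoc]⟩)
  · exact Or.inl (Or.inr ⟨n + 1, by rw [zpow_add_one₀ h0, mul_assoc]⟩)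
  · right
    simp

/-- The difference quotient `(f(t) - f(tq)) / (t(1-q))`; it is meaningful for `t ≠ 0`. -/
noncomputable def qQuotient (f : closedLattice q ζp ζm → 𝕜) (t : closedLattice q ζp ζm) : 𝕜 :=
  (f t - f ⟨t.1 * q, mul_mem_closedLattice t.2⟩) / ((t.1 * (1 - q) : ℝ) : 𝕜)

open Classical in
/-- The `q`-derivative: the difference quotient at the points of the lattice, and the limit of
the difference quotient at `0`. -/
noncomputable def qDeriv (f : closedLattice q ζp ζm → 𝕜) (t : closedLattice q ζp ζm) : 𝕜 :=
  if t = origin q ζp ζm then limUnder (𝓝[≠] origin q ζp ζm) (qQuotient f) else qQuotient f t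

/-- The class `Cⁿ`: `f` is continuous at `0` and, for `ℓ = 1, …, n`, the `ℓ`-th iterated
`q`-derivative `D_q^ℓ f(t)` has a limit as `t → 0` along the lattice. (The values of `D_q^ℓ f` on
the lattice do not depend on the values at `0` of the lower derivatives.) -/
def IsClassC (n : ℕ) (f : closedLattice q ζp ζm → 𝕜) : Prop :=
  ContinuousAt f (origin q ζp ζm) ∧
    ∀ ℓ : ℕ, 1 ≤ ℓ → ℓ ≤ n →
      ∃ c : 𝕜, Tendsto (qDeriv^[ℓ] f) (𝓝[≠] origin q ζp ζm) (𝓝 c)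

end Functions

end QBSpline

open QBSpline

namespace QBSpline

/-! ### Complete homogeneous symmetric polynomials -/

/-! Everything rests on one identity, `hasSum_linkEntry_mul_dividedDifference`: averaging the
divided differences `(D_q f)[Y]` over a row of the link matrix gives `[n+1]_q f[X]`. The divided
difference `f[X]`, times the Vandermonde determinant of `X`, is the determinant with columns `1, t,
…, tⁿ, f` evaluated at the knots. Subtracting consecutive rows removes the column of ones. Each
remaining entry `g(x_{i+1}) - g(x_i)` is the sum of `|y| (1-q) D_q g(y)` over `I(x_i, x_{i+1})`, by
telescoping. Multilinearity then turns the determinant into a sum over interlacing `Y`, and since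
`D_q` lowers the degree of monomials, each term is a determinant of the same shape for `D_q f` at
`Y`.

For `f = t^(n+1)` the identity says that the rows sum to one. Iterated, it gives (ii) for the row
measures (`integral_iterate_qDeriv`). For `f = t^(m+N-1)`, whose divided difference is `h_m`, it
gives their moments (`hasSplineMoments_linkMeasure`).

Row measures live on `[x₁, x_N]` and their moments are continuous in `X`. At a boundary point of
`G_N` compactness yields a limit with the right moments (`exists_hasSplineMoments`). Such a measure
is determined by its moments among all probability measures (`eq_of_moments_eq`), and convergence of
moments is weak convergence under a common bound on supports (`tendsto_of_tendsto_moments`). So the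
moment measures `B` form a continuous map that agrees with the rows on `G_N`, and density makes this
extension unique. -/

theorem eval_hsymm {σ : Type*} [Fintype σ] [DecidableEq σ] (X : σ → ℝ) (m : ℕ) :
    MvPolynomial.eval X (MvPolynomial.hsymm σ ℝ m) = ∑ s : Sym σ m, (s.1.map X).prod := by
  simp [MvPolynomial.hsymm, map_multiset_prod, Multiset.map_map]

/-- Multisets of size `m + 1` are split according to whether they contain `none`. -/
theorem eval_hsymm_option {σ : Type*} [Fintype σ] [DecidableEq σ] (X : Option σ → ℝ) (m : ℕ) :
    MvPolynomial.eval X (MvPolynomial.hsymm (Option σ) ℝ (m + 1)) =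
      X none * MvPolynomial.eval X (MvPolynomial.hsymm (Option σ) ℝ m) +
        MvPolynomial.eval (X ∘ some) (MvPolynomial.hsymm σ ℝ (m + 1)) := by
  simp only [eval_hsymm]
  rw [← Equiv.sum_comp (symOptionSuccEquiv (α := σ) (n := m)).symm, Fintype.sum_sum_type,
    Finset.mul_sum]
  congr 1
  · refine Finset.sum_congr rfl fun s _ => ?_
    change ((none ::ₘ (s : Multiset (Option σ))).map X).prod = _
    rw [Multiset.map_cons, Multiset.prod_cons]
    rfl
  · refine Finset.sum_congr rfl fun s _ => ?_
    change (((s.map Function.Embedding.some : Sym (Option σ) (m + 1)) :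
      Multiset (Option σ)).map X).prod = _
    simp [Multiset.map_map]

theorem completeHom_zero {N : ℕ} (X : Fin N → ℝ) : completeHom 0 X = 1 := by
  simp [completeHom]

theorem completeHom_succ_succAbove {N : ℕ} (X : Fin (N + 1) → ℝ) (p : Fin (N + 1)) (m : ℕ) :
    completeHom (m + 1) X =
      X p * completeHom m X + completeHom (m + 1) (X ∘ p.succAbove) := by
  have key : ∀ k, completeHom k X =
      MvPolynomial.eval (X ∘ (finSuccEquiv' p).symm) (MvPolynomial.hsymm (Option (Fin N)) ℝ k) := by
    intro k
    rw [← MvPolynomial.rename_hsymm _ _ k (finSuccEquiv' p), MvPolynomial.eval_rename]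
    congr 2
    ext i
    simp
  rw [key, key, eval_hsymm_option]
  congr 2

theorem completeHom_one_var (X : Fin 1 → ℝ) (m : ℕ) : completeHom m X = X 0 ^ m := by
  induction m with
  | zero => simp [completeHom_zero]
  | succ m ih =>
    rw [completeHom_succ_succAbove X 0, ih, pow_succ']
    have : IsEmpty (Sym (Fin 0) (m + 1)) := by
      refine ⟨fun s => ?_⟩
      have h : 0 < Multiset.card s.1 := by rw [s.2]; omega
      obtain ⟨a, -⟩ := Multiset.card_pos_iff_exists_mem.1 h
      exact a.elim0
    simp [completeHom, eval_hsymm]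

/-- Expand `h_{m+1}(X)` by removing either the first or the last variable and compare. This is the
recursion of divided differences of monomials. -/
theorem completeHom_tail_sub_init {N : ℕ} (X : Fin (N + 1) → ℝ) (m : ℕ) :
    completeHom (m + 1) (Fin.tail X) - completeHom (m + 1) (Fin.init X) =
      (X (Fin.last N) - X 0) * completeHom m X := by
  have h0 := completeHom_succ_succAbove X 0 m
  have h1 := completeHom_succ_succAbove X (Fin.last N) m
  have e0 : X ∘ (0 : Fin (N + 1)).succAbove = Fin.tail X := by
    ext i; simp [Fin.tail]
  have e1 : X ∘ (Fin.last N).succAbove = Fin.init X := by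
    ext i; simp [Fin.init]
  rw [e0] at h0
  rw [e1] at h1
  linarith

theorem continuous_completeHom (m N : ℕ) :
    Continuous fun X : Fin N → ℝ => completeHom m X := by
  simp only [completeHom, eval_hsymm]
  refine continuous_finsetSum _ fun s _ => ?_
  exact continuous_multiset_prod _ fun i _ => continuous_apply i

/-! ### Determinants -/

section Determinants

variable {𝕜 : Type} [RCLike 𝕜]

/-- If the first column of a matrix consists of ones, then its determinant is the minor of the
differences of consecutive rows. -/
theorem det_eq_det_row_sub {n : ℕ} (A : Matrix (Fin (n + 2)) (Fin (n + 2)) 𝕜)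
    (hA : ∀ i, A i 0 = 1) :
    A.det = (Matrix.of fun i j : Fin (n + 1) => A i.succ j.succ - A i.castSucc j.succ).det := by
  set B : Matrix (Fin (n + 2)) (Fin (n + 2)) 𝕜 :=
    Matrix.of fun i j => Fin.cases (A 0 j) (fun k => A k.succ j - A k.castSucc j) i with hB
  have h : A.det = B.det := by
    refine Matrix.det_eq_of_forall_row_eq_smul_add_pred (fun _ => 1) (fun j => ?_) fun i j => ?_
    · simp [hB]
    · simp [hB]
  rw [h, Matrix.det_succ_column_zero, Fin.sum_univ_succ, Finset.sum_eq_zero]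
  · have h0 : B 0 0 = 1 := by simp [hB, hA]
    rw [h0]
    simp only [Fin.val_zero, pow_zero, one_mul, add_zero]
    rfl
  · intro i _
    have : B i.succ 0 = 0 := by simp [hB, hA]
    rw [this]
    simp

/-- In `𝕜` every summable family is absolutely summable, so the product family is summable too. -/
theorem hasSum_mul_prod {ι κ : Type*} {f : ι → 𝕜} {g : κ → 𝕜} {a b : 𝕜} (hf : HasSum f a)
    (hg : HasSum g b) : HasSum (fun p : ι × κ => f p.1 * g p.2) (a * b) := by
  have hs := summable_mul_of_summable_norm hf.summable.norm hg.summable.norm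
  exact hf.mul hg hs

theorem hasSum_prod_fin {ι : Type*} {n : ℕ} (F : Fin n → ι → 𝕜) (S : Fin n → 𝕜)
    (h : ∀ i, HasSum (F i) (S i)) :
    HasSum (fun y : Fin n → ι => ∏ i, F i (y i)) (∏ i, S i) := by
  induction n with
  | zero => simp
  | succ n ih =>
    have h1 := ih (fun i => F i.succ) (fun i => S i.succ) fun i => h i.succ
    have h2 := hasSum_mul_prod (h 0) h1
    rw [Fin.prod_univ_succ, ← (Fin.consEquiv fun _ => ι).hasSum_iff]
    convert h2 using 2 with p
    simp [Fin.consEquiv, Fin.prod_univ_succ]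

/-- Multilinearity of the determinant in its rows, for infinite sums: row `i` depends on `y i`
alone, so each Leibniz term is a product of independent factors. -/
theorem hasSum_det {ι : Type*} {n : ℕ} (F : Fin n → ι → Fin n → 𝕜) (S : Matrix (Fin n) (Fin n) 𝕜)
    (h : ∀ i j, HasSum (fun y => F i y j) (S i j)) :
    HasSum (fun y : Fin n → ι => (Matrix.of fun i j => F i (y i) j).det) S.det := by
  have e : ∀ M : Matrix (Fin n) (Fin n) 𝕜,
      M.det = ∑ σ : Equiv.Perm (Fin n), ((Equiv.Perm.sign σ : ℤ) : 𝕜) * ∏ i, M i (σ i) := by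
    intro M
    rw [← Matrix.det_transpose M, Matrix.det_apply']
    rfl
  simp only [e, Matrix.of_apply]
  exact hasSum_sum fun σ _ =>
    (hasSum_prod_fin (fun i y => F i y (σ i)) _ fun i => h i (σ i)).mul_left _

end Determinants

/-! ### Divided differences -/

section DividedDifferences

variable {q ζp ζm : ℝ} {𝕜 : Type} [RCLike 𝕜]

theorem dividedDifference_const_mul (c : 𝕜) (f : closedLattice q ζp ζm → 𝕜) (N : ℕ)
    (x : Fin N → closedLattice q ζp ζm) :
    dividedDifference (fun t => c * f t) N x = c * dividedDifference f N x := by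
  induction N with
  | zero => simp [dividedDifference]
  | succ N ih =>
    cases N with
    | zero => rfl
    | succ N =>
      rw [dividedDifference, dividedDifference, ih, ih]
      ring

/-- The divided difference is the leading coefficient of an interpolating polynomial. -/
theorem exists_interpolating_polynomial (f : closedLattice q ζp ζm → 𝕜) {N : ℕ}
    (x : Fin (N + 1) → closedLattice q ζp ζm) (hx : Function.Injective x) :
    ∃ p : Polynomial 𝕜, p.natDegree ≤ N ∧ (∀ i, p.eval (((x i : ℝ)) : 𝕜) = f (x i)) ∧
      p.coeff N = dividedDifference f (N + 1) x := by
  induction N with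
  | zero =>
    refine ⟨Polynomial.C (f (x 0)), by simp, fun i => ?_, by simp [dividedDifference]⟩
    obtain rfl : i = 0 := Fin.fin_one_eq_zero i
    simp
  | succ N ih =>
    obtain ⟨p, hpd, hpe, hpc⟩ := ih (Fin.tail x) (hx.comp (Fin.succ_injective _))
    obtain ⟨r, hrd, hre, hrc⟩ := ih (Fin.init x) (hx.comp (Fin.castSucc_injective _))
    set a : 𝕜 := ((x 0 : ℝ) : 𝕜)
    set b : 𝕜 := ((x (Fin.last (N + 1)) : ℝ) : 𝕜)
    have hab : b - a ≠ 0 := by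
      rw [sub_ne_zero]
      intro h
      have : x (Fin.last (N + 1)) = x 0 := Subtype.ext (RCLike.ofReal_injective h)
      exact absurd (hx this) (Fin.last_pos).ne'
    -- Neville's combination of `p`, which interpolates away from the first knot, and `r`, which
    -- interpolates away from the last.
    refine ⟨Polynomial.C ((b - a)⁻¹) *
      ((Polynomial.X - Polynomial.C a) * p - (Polynomial.X - Polynomial.C b) * r), ?_, ?_, ?_⟩
    · refine (Polynomial.natDegree_C_mul_le _ _).trans ((Polynomial.natDegree_sub_le _ _).trans ?_)
      refine max_le ?_ ?_
      · refine Polynomial.natDegree_mul_le.trans ?_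
        rw [Polynomial.natDegree_X_sub_C]
        omega
      · refine Polynomial.natDegree_mul_le.trans ?_
        rw [Polynomial.natDegree_X_sub_C]
        omega
    · intro i
      simp only [Polynomial.eval_mul, Polynomial.eval_C, Polynomial.eval_sub, Polynomial.eval_X]
      rcases Fin.eq_castSucc_or_eq_last i with ⟨j, rfl⟩ | rfl
      · have hj : r.eval ((x j.castSucc : ℝ) : 𝕜) = f (x j.castSucc) := hre j
        rcases Fin.eq_zero_or_eq_succ j.castSucc with h0 | ⟨k, hk⟩
        · rw [h0] at hj ⊢
          rw [hj]
          change (b - a)⁻¹ * ((a - a) * _ - (a - b) * _) = _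
          field_simp
          ring
        · have h1 : p.eval ((x j.castSucc : ℝ) : 𝕜) = f (x j.castSucc) := by
            rw [hk]; exact hpe k
          rw [hj, h1]
          field_simp
          ring
      · have h1 : p.eval b = f (x (Fin.last (N + 1))) := hpe (Fin.last N)
        change (b - a)⁻¹ * ((b - a) * p.eval b - (b - b) * _) = _
        rw [h1]
        field_simp
        ring
    · rw [dividedDifference, ← hpc, ← hrc]
      have e : ∀ (s : Polynomial 𝕜) (c : 𝕜), s.natDegree ≤ N →
          ((Polynomial.X - Polynomial.C c) * s).coeff (N + 1) = s.coeff N := by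
        intro s c hs
        rw [sub_mul, Polynomial.coeff_sub, Polynomial.coeff_X_mul, Polynomial.coeff_C_mul,
          Polynomial.coeff_eq_zero_of_natDegree_lt (n := N + 1) (by omega)]
        simp
      rw [Polynomial.coeff_C_mul, Polynomial.coeff_sub, e p a hpd, e r b hrd]
      simp only [RCLike.ofReal_sub]
      rw [div_eq_mul_inv, mul_comm]

/-- The divided difference as a quotient of determinants. -/
theorem det_updateCol_vandermonde (f : closedLattice q ζp ζm → 𝕜) {N : ℕ}
    (x : Fin (N + 1) → closedLattice q ζp ζm) (hx : Function.Injective x) :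
    ((Matrix.vandermonde fun i => (((x i : ℝ)) : 𝕜)).updateCol (Fin.last N) fun i => f (x i)).det =
      (Matrix.vandermonde fun i => (((x i : ℝ)) : 𝕜)).det * dividedDifference f (N + 1) x := by
  obtain ⟨p, hpd, hpe, hpc⟩ := exists_interpolating_polynomial f x hx
  set A := Matrix.vandermonde fun i => (((x i : ℝ)) : 𝕜)
  have hf : (fun i => f (x i)) = A.mulVec fun j => p.coeff j := by
    ext i
    rw [← hpe i, Polynomial.eval_eq_sum_range' (n := N + 1) (by omega), ← Fin.sum_univ_eq_sum_range
      (fun j => p.coeff j * (((x i : ℝ)) : 𝕜) ^ j)]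
    simp [Matrix.mulVec, dotProduct, A, Matrix.vandermonde_apply, mul_comm]
  -- Cramer's rule: the new column is `A` applied to the coefficients of `p`, so the determinant
  -- extracts the last coefficient.
  rw [hf, ← Matrix.cramer_apply, Matrix.cramer_eq_adjugate_mulVec, Matrix.mulVec_mulVec,
    Matrix.adjugate_mul, Matrix.smul_mulVec, Matrix.one_mulVec, ← hpc]
  simp

theorem dividedDifference_pow (N m : ℕ) (x : Fin (N + 1) → closedLattice q ζp ζm)
    (hx : Function.Injective x) :
    dividedDifference (fun t : closedLattice q ζp ζm => (((t : ℝ)) : 𝕜) ^ (m + N)) (N + 1) x =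
      ((completeHom m fun i => (x i : ℝ) : ℝ) : 𝕜) := by
  induction N generalizing m with
  | zero => simp [dividedDifference, completeHom_one_var]
  | succ N ih =>
    have e : m + (N + 1) = (m + 1) + N := by ring
    have hab : ((x (Fin.last (N + 1)) : ℝ) - (x 0 : ℝ)) ≠ 0 := by
      rw [sub_ne_zero]
      intro h
      exact absurd (hx (Subtype.ext h)) (Fin.last_pos).ne'
    rw [dividedDifference, e, ih (m + 1) (Fin.tail x) (hx.comp (Fin.succ_injective _)),
      ih (m + 1) (Fin.init x) (hx.comp (Fin.castSucc_injective _)), ← RCLike.ofReal_sub,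
      ← RCLike.ofReal_div, RCLike.ofReal_inj, div_eq_iff hab, mul_comm]
    exact completeHom_tail_sub_init (fun i => (x i : ℝ)) m

end DividedDifferences

section QCalculus

variable {q ζp ζm : ℝ} {𝕜 : Type} [RCLike 𝕜]

/-! ### The lattice near the origin -/

theorem ne_zero_of_mem_lattice (hq0 : 0 < q) (hζp : 0 < ζp) (hζm : ζm < 0) {t : ℝ}
    (ht : t ∈ lattice q ζp ζm) : t ≠ 0 := by
  rcases ht with ⟨n, rfl⟩ | ⟨n, rfl⟩
  · exact mul_ne_zero hζp.ne' (zpow_pos hq0 n).ne'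
  · exact mul_ne_zero hζm.ne (zpow_pos hq0 n).ne'

theorem mul_pow_mem_lattice (hq0 : 0 < q) {b : ℝ} (hb : b ∈ lattice q ζp ζm) (n : ℕ) :
    b * q ^ n ∈ lattice q ζp ζm := by
  rcases hb with ⟨m, rfl⟩ | ⟨m, rfl⟩
  · exact Or.inl ⟨m + n, by rw [zpow_add₀ hq0.ne', zpow_natCast, mul_assoc]⟩
  · exact Or.inr ⟨m + n, by rw [zpow_add₀ hq0.ne', zpow_natCast, mul_assoc]⟩

/-- The geometric sequence `b, bq, bq², …` in the closed lattice. -/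
def geomSeq (hq0 : 0 < q) (b : lattice q ζp ζm) (n : ℕ) : closedLattice q ζp ζm :=
  ⟨b.1 * q ^ n, Or.inl (mul_pow_mem_lattice hq0 b.2 n)⟩

theorem tendsto_geomSeq (hq0 : 0 < q) (hq1 : q < 1) (hζp : 0 < ζp) (hζm : ζm < 0)
    (b : lattice q ζp ζm) :
    Tendsto (geomSeq hq0 b) atTop (𝓝[≠] origin q ζp ζm) := by
  refine tendsto_nhdsWithin_iff.2 ⟨?_, Eventually.of_forall fun n h => ?_⟩
  · rw [tendsto_subtype_rng]
    simpa [geomSeq, origin] using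
      (tendsto_pow_atTop_nhds_zero_of_lt_one hq0.le hq1).const_mul b.1
  · exact ne_zero_of_mem_lattice hq0 hζp hζm (mul_pow_mem_lattice hq0 b.2 n)
      (congrArg Subtype.val h)

theorem neBot_nhdsNE_origin (hq0 : 0 < q) (hq1 : q < 1) (hζp : 0 < ζp) (hζm : ζm < 0) :
    (𝓝[≠] origin q ζp ζm).NeBot :=
  (tendsto_geomSeq hq0 hq1 hζp hζm ⟨ζp, Or.inl ⟨0, by simp⟩⟩).neBot

theorem qDeriv_of_ne {f : closedLattice q ζp ζm → 𝕜} {t : closedLattice q ζp ζm}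
    (ht : (t : ℝ) ≠ 0) : qDeriv f t = qQuotient f t := by
  rw [qDeriv, if_neg]
  rintro rfl
  exact ht rfl

theorem qDeriv_eventuallyEq (f : closedLattice q ζp ζm → 𝕜) :
    qDeriv f =ᶠ[𝓝[≠] origin q ζp ζm] qQuotient f := by
  filter_upwards [self_mem_nhdsWithin] with t ht
  exact qDeriv_of_ne fun h => ht (Subtype.ext h)

theorem qDeriv_origin (hq0 : 0 < q) (hq1 : q < 1) (hζp : 0 < ζp) (hζm : ζm < 0)
    {f : closedLattice q ζp ζm → 𝕜} {c : 𝕜}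
    (hc : Tendsto (qQuotient f) (𝓝[≠] origin q ζp ζm) (𝓝 c)) :
    qDeriv f (origin q ζp ζm) = c := by
  have := neBot_nhdsNE_origin hq0 hq1 hζp hζm
  rw [qDeriv, if_pos rfl]
  exact hc.limUnder_eq

theorem mul_qDeriv (hq1 : q < 1) (f : closedLattice q ζp ζm → 𝕜)
    {t : closedLattice q ζp ζm} (ht : (t : ℝ) ≠ 0) :
    (((t : ℝ) * (1 - q) : ℝ) : 𝕜) * qDeriv f t =
      f t - f ⟨t.1 * q, mul_mem_closedLattice t.2⟩ := by
  rw [qDeriv_of_ne ht, qQuotient, mul_div_cancel₀]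
  exact RCLike.ofReal_ne_zero.2 (mul_ne_zero ht (sub_pos.2 hq1).ne')

/-! ### The `q`-derivative of a monomial -/

theorem qDeriv_pow (hq0 : 0 < q) (hq1 : q < 1) (hζp : 0 < ζp) (hζm : ζm < 0) (m : ℕ) :
    qDeriv (fun t : closedLattice q ζp ζm => (((t : ℝ)) : 𝕜) ^ (m + 1)) =
      fun t : closedLattice q ζp ζm => ((qNumber q (m + 1) : ℝ) : 𝕜) * (((t : ℝ)) : 𝕜) ^ m := by
  have key : ∀ t : closedLattice q ζp ζm, (t : ℝ) ≠ 0 →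
      qQuotient (fun t : closedLattice q ζp ζm => (((t : ℝ)) : 𝕜) ^ (m + 1)) t =
        ((qNumber q (m + 1) : ℝ) : 𝕜) * (((t : ℝ)) : 𝕜) ^ m := by
    intro t ht
    have h1 : (1 - q) ≠ 0 := (sub_pos.2 hq1).ne'
    simp only [qQuotient, qNumber, ← RCLike.ofReal_pow, ← RCLike.ofReal_sub,
      ← RCLike.ofReal_mul, ← RCLike.ofReal_div]
    congr 1
    field_simp
    ring
  funext t
  by_cases ht : (t : ℝ) = 0
  · obtain rfl : t = origin q ζp ζm := Subtype.ext ht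
    refine qDeriv_origin hq0 hq1 hζp hζm ?_
    have hcont : Continuous fun t : closedLattice q ζp ζm =>
        ((qNumber q (m + 1) : ℝ) : 𝕜) * (((t : ℝ)) : 𝕜) ^ m := by fun_prop
    refine (hcont.tendsto (origin q ζp ζm)).mono_left nhdsWithin_le_nhds |>.congr' ?_
    filter_upwards [self_mem_nhdsWithin] with t ht
    exact (key t fun h => ht (Subtype.ext h)).symm
  · rw [qDeriv_of_ne ht, key t ht]

/-! ### The fundamental theorem of `q`-calculus -/

/-- `y` lies between `0` (excluded) and `b` (included). -/
def InRay (b y : ℝ) : Prop := (0 < y ∧ y ≤ b) ∨ (b ≤ y ∧ y < 0)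

theorem exists_eq_mul_pow_of_inRay (hq0 : 0 < q) (hq1 : q < 1) (hζp : 0 < ζp) (hζm : ζm < 0)
    {b y : ℝ} (hb : b ∈ lattice q ζp ζm) (hy : y ∈ closedLattice q ζp ζm) (h : InRay b y) :
    ∃ n : ℕ, y = b * q ^ n := by
  have aux : ∀ k m : ℤ, q ^ k ≤ q ^ m → ∃ n : ℕ, q ^ k = q ^ m * q ^ n := by
    intro k m hkm
    have : m ≤ k := by
      by_contra hlt
      exact absurd hkm (not_le.2 (zpow_lt_zpow_right_of_lt_one₀ hq0 hq1 (not_le.1 hlt)))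
    refine ⟨(k - m).toNat, ?_⟩
    rw [← zpow_natCast, Int.toNat_of_nonneg (by omega), ← zpow_add₀ hq0.ne']
    congr 1
    ring
  have hpos := fun n : ℤ => mul_pos hζp (zpow_pos hq0 n)
  have hneg := fun n : ℤ => mul_neg_of_neg_of_pos hζm (zpow_pos hq0 n)
  rcases hb with ⟨m, rfl⟩ | ⟨m, rfl⟩ <;> rcases hy with (⟨k, rfl⟩ | ⟨k, rfl⟩) | rfl <;>
    rcases h with ⟨h1, h2⟩ | ⟨h1, h2⟩
  -- Only the cases with `b` and `y` strictly on the same side of `0` survive.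
  all_goals first
    | exact absurd h1 (lt_irrefl _)
    | exact absurd h2 (lt_irrefl _)
    | exact absurd h1 (hneg _).not_gt
    | exact absurd h2 (hpos _).not_gt
    | exact absurd h2 ((hneg _).trans (hpos _)).not_ge
    | exact absurd h1 ((hneg _).trans (hpos _)).not_ge
    | skip
  · obtain ⟨n, hn⟩ := aux k m (le_of_mul_le_mul_left h2 hζp)
    exact ⟨n, by rw [hn, mul_assoc]⟩
  · obtain ⟨n, hn⟩ := aux k m ((mul_le_mul_left_of_neg hζm).1 h1)
    exact ⟨n, by rw [hn, mul_assoc]⟩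

open Classical in
-- The terms along `b, bq, bq², …` are `f(t) - f(tq)` and telescope down to `f(0)`. The weight `y
-- (1-q)` is signed, so rays on both sides of `0` are treated alike.
theorem hasSum_ray (hq0 : 0 < q) (hq1 : q < 1) (hζp : 0 < ζp) (hζm : ζm < 0)
    {f : closedLattice q ζp ζm → 𝕜} (hf : ContinuousAt f (origin q ζp ζm)) {c : 𝕜}
    (hc : Tendsto (qDeriv f) (𝓝[≠] origin q ζp ζm) (𝓝 c)) (b : lattice q ζp ζm) :
    HasSum (fun y : closedLattice q ζp ζm =>
        (((if InRay b y then (y : ℝ) * (1 - q) else 0 : ℝ)) : 𝕜) * qDeriv f y)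
      (f ⟨b, Or.inl b.2⟩ - f (origin q ζp ζm)) := by
  have hb0 : (b : ℝ) ≠ 0 := ne_zero_of_mem_lattice hq0 hζp hζm b.2
  have hlim := tendsto_geomSeq hq0 hq1 hζp hζm b
  have hinj : Function.Injective (geomSeq hq0 b) := by
    intro m n h
    have h1 : (b : ℝ) * q ^ m = b * q ^ n := congrArg Subtype.val h
    exact (pow_right_strictAnti₀ hq0 hq1).injective (mul_left_cancel₀ hb0 h1)
  have hne : ∀ n, (geomSeq hq0 b n : ℝ) ≠ 0 := fun n =>
    ne_zero_of_mem_lattice hq0 hζp hζm (mul_pow_mem_lattice hq0 b.2 n)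
  have hstep : ∀ n, (((geomSeq hq0 b n : ℝ) * (1 - q) : ℝ) : 𝕜) * qDeriv f (geomSeq hq0 b n) =
      f (geomSeq hq0 b n) - f (geomSeq hq0 b (n + 1)) := by
    intro n
    rw [mul_qDeriv hq1 f (hne n)]
    congr 2
    exact Subtype.ext (by simp [geomSeq, pow_succ, mul_assoc])
  have hray : ∀ n, InRay b (geomSeq hq0 b n) := by
    intro n
    have hp := pow_pos hq0 n
    have hle : q ^ n ≤ 1 := pow_le_one₀ hq0.le hq1.le
    rcases lt_or_gt_of_ne hb0 with h | h
    · exact Or.inr ⟨by simp only [geomSeq]; nlinarith, mul_neg_of_neg_of_pos h hp⟩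
    · exact Or.inl ⟨mul_pos h hp, by simp only [geomSeq]; nlinarith⟩
  rw [← hinj.hasSum_iff]
  · have hsum : Summable fun n => f (geomSeq hq0 b n) - f (geomSeq hq0 b (n + 1)) := by
      -- `D_q f` converges along the ray, hence is bounded there, and the weights decay
      -- geometrically.
      obtain ⟨C, hC⟩ := (hc.comp hlim).norm.bddAbove_range
      refine Summable.of_norm_bounded
        ((summable_geometric_of_lt_one hq0.le hq1).mul_left (|(b : ℝ)| * (1 - q) * C)) fun n => ?_
      have h1 : ‖qDeriv f (geomSeq hq0 b n)‖ ≤ C := hC ⟨n, rfl⟩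
      rw [← hstep, norm_mul, RCLike.norm_ofReal, abs_mul, abs_of_pos (sub_pos.2 hq1)]
      have h2 : |(geomSeq hq0 b n : ℝ)| = |(b : ℝ)| * q ^ n := by
        simp [geomSeq, abs_mul, abs_of_pos hq0]
      rw [h2]
      calc |(b : ℝ)| * q ^ n * (1 - q) * ‖qDeriv f (geomSeq hq0 b n)‖
          ≤ |(b : ℝ)| * q ^ n * (1 - q) * C := by
            refine mul_le_mul_of_nonneg_left h1 ?_
            have := sub_pos.2 hq1
            positivity
        _ = |(b : ℝ)| * (1 - q) * C * q ^ n := by ring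
    have h0 : geomSeq hq0 b 0 = ⟨b, Or.inl b.2⟩ := Subtype.ext (by simp [geomSeq])
    have htend : Tendsto (fun n => ∑ i ∈ Finset.range n,
        (f (geomSeq hq0 b i) - f (geomSeq hq0 b (i + 1)))) atTop
        (𝓝 (f ⟨b, Or.inl b.2⟩ - f (origin q ζp ζm))) := by
      simp only [Finset.sum_range_sub', h0]
      exact tendsto_const_nhds.sub (hf.tendsto.comp (hlim.mono_right nhdsWithin_le_nhds))
    have := hsum.hasSum
    rw [tendsto_nhds_unique this.tendsto_sum_nat htend] at this
    convert this using 2 with n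
    rw [Function.comp_apply, if_pos (hray n), hstep]
  · intro y hy
    rw [if_neg, RCLike.ofReal_zero, zero_mul]
    intro h
    obtain ⟨n, hn⟩ := exists_eq_mul_pow_of_inRay hq0 hq1 hζp hζm b.2 y.2 h
    exact hy ⟨n, Subtype.ext hn.symm⟩

open Classical in
-- The endpoint conventions of `I(a, b)` are exactly those of a difference of two signed rays from
-- `0`. For `a < 0 < b` the rays are disjoint and both endpoints remain.
theorem ite_latticeInterval_eq (hq0 : 0 < q) (hζp : 0 < ζp) (hζm : ζm < 0) {a b y : ℝ}
    (ha : a ∈ lattice q ζp ζm) (hb : b ∈ lattice q ζp ζm) (hab : a < b)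
    (hy : y ∈ closedLattice q ζp ζm) :
    (if y ∈ latticeInterval q ζp ζm a b then |y| else 0) =
      (if InRay b y then y else 0) - (if InRay a y then y else 0) := by
  have ha0 := ne_zero_of_mem_lattice hq0 hζp hζm ha
  have hb0 := ne_zero_of_mem_lattice hq0 hζp hζm hb
  rcases hy with hy | rfl
  · have hy0 := ne_zero_of_mem_lattice hq0 hζp hζm hy
    simp only [latticeInterval, InRay, Set.mem_ofPred_eq, hy, true_and]
    rcases lt_or_gt_of_ne hy0 with h | h
    · rw [abs_of_neg h]
      split_ifs <;> grind
    · rw [abs_of_pos h]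
      split_ifs <;> grind
  · simp

/-- The integral of the `q`-derivative over an interval of the lattice. -/
theorem hasSum_qDeriv_latticeInterval (hq0 : 0 < q) (hq1 : q < 1) (hζp : 0 < ζp) (hζm : ζm < 0)
    {f : closedLattice q ζp ζm → 𝕜} (hf : ContinuousAt f (origin q ζp ζm)) {c : 𝕜}
    (hc : Tendsto (qDeriv f) (𝓝[≠] origin q ζp ζm) (𝓝 c)) (a b : lattice q ζp ζm)
    (hab : (a : ℝ) < b) (w : closedLattice q ζp ζm → ℝ)
    (hw : ∀ y : closedLattice q ζp ζm, (y : ℝ) ∈ latticeInterval q ζp ζm a b → w y = |(y : ℝ)| * (1 - q))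
    (hw' : ∀ y : closedLattice q ζp ζm, (y : ℝ) ∉ latticeInterval q ζp ζm a b → w y = 0) :
    HasSum (fun y => ((w y : ℝ) : 𝕜) * qDeriv f y)
      (f ⟨b, Or.inl b.2⟩ - f ⟨a, Or.inl a.2⟩) := by
  classical
  have h := (hasSum_ray hq0 hq1 hζp hζm hf hc b).sub (hasSum_ray hq0 hq1 hζp hζm hf hc a)
  rw [sub_sub_sub_cancel_right] at h
  refine (congrArg (fun F => HasSum F _) (funext fun y => ?_)).mpr h
  rw [← sub_mul, ← RCLike.ofReal_sub]
  congr 2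
  have e := ite_latticeInterval_eq hq0 hζp hζm a.2 b.2 hab y.2
  have e' : w y = (if (y : ℝ) ∈ latticeInterval q ζp ζm a b then |(y : ℝ)| else 0) * (1 - q) := by
    split_ifs with hy
    · exact hw y hy
    · rw [hw' y hy, zero_mul]
  rw [e', e, sub_mul, ite_mul, ite_mul, zero_mul]

end QCalculus

/-! ### One link step, iterated `q`-derivatives and row sums. -/

section Link

variable {q ζp ζm : ℝ} {𝕜 : Type} [RCLike 𝕜]

theorem knots_injective {N : ℕ} (X : level q ζp ζm N) : Function.Injective (knots X) :=
  fun _ _ h => X.2.1.injective (congrArg Subtype.val h)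

theorem det_vandermonde_pos {N : ℕ} {X : Fin N → ℝ} (hX : StrictMono X) :
    0 < (Matrix.vandermonde X).det := by
  rw [Matrix.det_vandermonde]
  exact Finset.prod_pos fun i _ => Finset.prod_pos fun j hj =>
    sub_pos.2 (hX (Finset.mem_Ioi.1 hj))

theorem abs_vandermonde {N : ℕ} {X : Fin N → ℝ} (hX : StrictMono X) :
    |vandermonde X| = (Matrix.vandermonde X).det := by
  rw [← abs_of_pos (det_vandermonde_pos hX), Matrix.det_vandermonde, vandermonde]
  simp only [Finset.abs_prod, abs_sub_comm]

theorem ofReal_det_vandermonde {N : ℕ} (X : Fin N → ℝ) :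
    (Matrix.vandermonde fun i => ((X i : ℝ) : 𝕜)).det = (((Matrix.vandermonde X).det : ℝ) : 𝕜) := by
  simp [Matrix.det_vandermonde]

theorem qNumber_pos (hq0 : 0 < q) (hq1 : q < 1) (n : ℕ) : 0 < qNumber q (n + 1) :=
  div_pos (sub_pos.2 (pow_lt_one₀ hq0.le hq1 n.succ_ne_zero)) (sub_pos.2 hq1)

theorem qFactorial_zero : qFactorial q 0 = 1 := by simp [qFactorial]

theorem qFactorial_succ (n : ℕ) : qFactorial q (n + 1) = qFactorial q n * qNumber q (n + 1) :=
  Finset.prod_range_succ _ _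

theorem qFactorial_pos (hq0 : 0 < q) (hq1 : q < 1) (n : ℕ) : 0 < qFactorial q n :=
  Finset.prod_pos fun i _ => qNumber_pos hq0 hq1 i

theorem qPochhammer_self (hq1 : q < 1) (n : ℕ) :
    qPochhammer q q n = (1 - q) ^ n * qFactorial q n := by
  have h : (1 - q) ≠ 0 := (sub_pos.2 hq1).ne'
  have e : (1 - q) ^ n = ∏ _i ∈ Finset.range n, (1 - q) := by simp
  rw [qPochhammer, qFactorial, e, ← Finset.prod_mul_distrib]
  refine Finset.prod_congr rfl fun i _ => ?_
  rw [qNumber, mul_div_cancel₀ _ h, pow_succ']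

theorem linkEntry_nonneg (hq0 : 0 < q) (hq1 : q < 1) {N : ℕ} (X : Fin (N + 1) → ℝ)
    (Y : Fin N → ℝ) : 0 ≤ linkEntry q ζp ζm X Y := by
  rw [linkEntry]
  split_ifs
  · rw [qPochhammer_self hq1]
    have := sub_pos.2 hq1
    have := qFactorial_pos hq0 hq1 N
    have : 0 ≤ ∏ i, |Y i| := Finset.prod_nonneg fun i _ => abs_nonneg _
    positivity
  · exact le_rfl

/-- Neighbouring intervals meet at most at a shared knot, and the half-open convention assigns that
knot to only one of them. Hence every interlacing tuple of lattice points is a configuration. -/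
theorem strictMono_of_interlace {N : ℕ} {X : Fin (N + 1) → ℝ} (hX : StrictMono X) {Y : Fin N → ℝ}
    (h : Interlace q ζp ζm X Y) : StrictMono Y := by
  cases N with
  | zero => exact fun i => i.elim0
  | succ N =>
    refine Fin.strictMono_iff_lt_succ.2 fun i => ?_
    have h1 := (h i.castSucc).2
    have h2 := (h i.succ).2
    have h3 : X i.castSucc.castSucc < X i.succ.castSucc := hX (by simp [Fin.lt_def])
    have h4 : X i.succ.castSucc < X i.succ.succ := hX (by simp [Fin.lt_def])
    rw [Fin.succ_castSucc] at h1
    rcases h1 with ⟨_, _, _⟩ | ⟨_, _, _, _⟩ | ⟨_, _, _⟩ <;>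
      rcases h2 with ⟨_, _, _⟩ | ⟨_, _, _, _⟩ | ⟨_, _, _⟩ <;> linarith

/-- The product of the `q`-integers `[j + 1]`, `j < n`. -/
theorem prod_ite_last_qNumber (n : ℕ) :
    ∏ j : Fin (n + 1), (if j = Fin.last n then (1 : ℝ) else qNumber q (j + 1)) =
      qFactorial q n := by
  rw [Fin.prod_univ_castSucc, qFactorial, Finset.prod_range]
  simp [(Fin.castSucc_lt_last _).ne]

/-- One step of the link between divided differences of a function and of its `q`-derivative. -/
theorem hasSum_linkEntry_mul_dividedDifference (hq0 : 0 < q) (hq1 : q < 1) (hζp : 0 < ζp)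
    (hζm : ζm < 0) {f : closedLattice q ζp ζm → 𝕜} (hf : ContinuousAt f (origin q ζp ζm)) {c : 𝕜}
    (hc : Tendsto (qDeriv f) (𝓝[≠] origin q ζp ζm) (𝓝 c)) {n : ℕ} (X : level q ζp ζm (n + 2)) :
    HasSum (fun Y : level q ζp ζm (n + 1) => ((linkEntry q ζp ζm X.1 Y.1 : ℝ) : 𝕜) *
        dividedDifference (qDeriv f) (n + 1) (knots Y))
      (((qNumber q (n + 1) : ℝ) : 𝕜) * dividedDifference f (n + 2) (knots X)) := by
  classical
  -- The columns `1, t, …, tⁿ, f` of the determinant.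
  set G : Fin (n + 2) → closedLattice q ζp ζm → 𝕜 := fun j =>
    if j = Fin.last (n + 1) then f else fun t => (((t : ℝ)) : 𝕜) ^ (j : ℕ) with hG
  have hGD : ∀ j : Fin (n + 1), qDeriv (G j.succ) = fun t : closedLattice q ζp ζm =>
      (((if j = Fin.last n then (1 : ℝ) else qNumber q (j + 1) : ℝ)) : 𝕜) *
        (if j = Fin.last n then qDeriv f t else (((t : ℝ)) : 𝕜) ^ (j : ℕ)) := by
    intro j
    by_cases hj : j = Fin.last n
    · subst hj
      simp [hG]
    · have : j.succ ≠ Fin.last (n + 1) := fun h => hj (Fin.succ_injective _ h)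
      simp only [hG, this, hj, if_false, Fin.val_succ]
      exact qDeriv_pow hq0 hq1 hζp hζm j
  have hGc : ∀ j, ContinuousAt (G j) (origin q ζp ζm) := by
    intro j
    by_cases hj : j = Fin.last (n + 1)
    · simpa [hG, hj] using hf
    · simp only [hG, hj, if_false]
      fun_prop
  have hGl : ∀ j : Fin (n + 1), ∃ d : 𝕜,
      Tendsto (qDeriv (G j.succ)) (𝓝[≠] origin q ζp ζm) (𝓝 d) := by
    intro j
    rw [hGD]
    by_cases hj : j = Fin.last n
    · exact ⟨c, by simpa [hj] using hc⟩
    · have hcont : Continuous fun t : closedLattice q ζp ζm =>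
          ((qNumber q (j + 1) : ℝ) : 𝕜) * (((t : ℝ)) : 𝕜) ^ (j : ℕ) := by fun_prop
      simp only [hj, if_false]
      exact ⟨_, (hcont.tendsto (origin q ζp ζm)).mono_left nhdsWithin_le_nhds⟩
  -- the determinant of the rows `G j (x i)`
  have hdet : (Matrix.of fun i j => G j (knots X i)).det =
      (((Matrix.vandermonde X.1).det : ℝ) : 𝕜) * dividedDifference f (n + 2) (knots X) := by
    rw [← ofReal_det_vandermonde]
    refine Eq.trans ?_ (det_updateCol_vandermonde f (knots X) (knots_injective X))
    congr 1
    ext i j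
    by_cases hj : j = Fin.last (n + 1)
    · simp [hG, hj]
    · simp [hG, hj, Matrix.updateCol_ne, Matrix.vandermonde_apply]
  rw [det_eq_det_row_sub _ (by
    intro i
    have : (0 : Fin (n + 2)) ≠ Fin.last (n + 1) := (Fin.last_pos).ne
    simp [hG, this])] at hdet
  set w : Fin (n + 1) → closedLattice q ζp ζm → ℝ := fun i y =>
    if (y : ℝ) ∈ latticeInterval q ζp ζm (X.1 i.castSucc) (X.1 i.succ)
      then |(y : ℝ)| * (1 - q) else 0 with hw
  have hS := hasSum_det (fun (i : Fin (n + 1)) (y : closedLattice q ζp ζm) (j : Fin (n + 1)) =>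
      ((w i y : ℝ) : 𝕜) * qDeriv (G j.succ) y)
    (Matrix.of fun i j : Fin (n + 1) =>
      G j.succ (knots X i.succ) - G j.succ (knots X i.castSucc)) (by
    intro i j
    obtain ⟨d, hd⟩ := hGl j
    exact hasSum_qDeriv_latticeInterval hq0 hq1 hζp hζm (hGc j.succ) hd
      ⟨X.1 i.castSucc, X.2.2 _⟩ ⟨X.1 i.succ, X.2.2 _⟩ (X.2.1 (Fin.castSucc_lt_succ))
      (w i) (fun y hy => if_pos hy) (fun y hy => if_neg hy))
  simp only [Matrix.of_apply] at hS hdet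
  rw [hdet] at hS
  -- Row factors are the weights `w i`; column factors are the `[j+1]_q` from differentiating
  -- monomials, with product `[n]_q!`. The last column contributes no factor.
  have hterm : ∀ y : Fin (n + 1) → closedLattice q ζp ζm,
      (Matrix.of fun i j : Fin (n + 1) => ((w i (y i) : ℝ) : 𝕜) * qDeriv (G j.succ) (y i)).det =
        (((∏ i, w i (y i)) * qFactorial q n : ℝ) : 𝕜) *
          ((Matrix.vandermonde fun i => (((y i : ℝ)) : 𝕜)).updateCol (Fin.last n)
            fun i => qDeriv f (y i)).det := by
    intro y
    have e1 := Matrix.det_mul_column (fun i => ((w i (y i) : ℝ) : 𝕜))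
      (Matrix.of fun i j : Fin (n + 1) => qDeriv (G j.succ) (y i))
    have e2 := Matrix.det_mul_row
      (fun j : Fin (n + 1) =>
        (((if j = Fin.last n then (1 : ℝ) else qNumber q (j + 1) : ℝ)) : 𝕜))
      ((Matrix.vandermonde fun i => (((y i : ℝ)) : 𝕜)).updateCol (Fin.last n)
            fun i => qDeriv f (y i))
    simp only [Matrix.of_apply] at e1
    rw [e1, ← prod_ite_last_qNumber, RCLike.ofReal_mul, mul_assoc, RCLike.ofReal_prod,
      RCLike.ofReal_prod, ← e2]
    congr 2
    ext i j
    simp only [hGD, Matrix.of_apply]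
    by_cases hj : j = Fin.last n
    · simp [hj]
    · simp [hj, Matrix.updateCol_ne, Matrix.vandermonde_apply]
  simp only [hterm] at hS
  have hinj : Function.Injective (knots : level q ζp ζm (n + 1) → _) := fun Y Z h =>
    Subtype.ext (funext fun i => congrArg Subtype.val (congrFun h i))
  rw [← hinj.hasSum_iff] at hS
  · have hVX := det_vandermonde_pos X.2.1
    -- The factor `[n+1]_q` completes `[n]_q! (1-q)^(n+1)` to `(q;q)_{n+1}`, the constant in
    -- `linkEntry`.
    have hS' := hS.mul_left (((qNumber q (n + 1) / (Matrix.vandermonde X.1).det : ℝ)) : 𝕜)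
    have hV0 : (((Matrix.vandermonde X.1).det : ℝ) : 𝕜) ≠ 0 := RCLike.ofReal_ne_zero.2 hVX.ne'
    have e3 : (((qNumber q (n + 1) / (Matrix.vandermonde X.1).det : ℝ)) : 𝕜) *
        ((((Matrix.vandermonde X.1).det : ℝ) : 𝕜) * dividedDifference f (n + 2) (knots X)) =
        ((qNumber q (n + 1) : ℝ) : 𝕜) * dividedDifference f (n + 2) (knots X) := by
      rw [RCLike.ofReal_div]
      field_simp
    rw [e3] at hS'
    refine (congrArg (fun F => HasSum F _) (funext fun Y => ?_)).mpr hS'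
    rw [Function.comp_apply, det_updateCol_vandermonde _ _ (knots_injective Y)]
    have e4 : (Matrix.vandermonde fun i => (((knots Y i : ℝ)) : 𝕜)).det =
        (((Matrix.vandermonde Y.1).det : ℝ) : 𝕜) := ofReal_det_vandermonde Y.1
    rw [e4, ← mul_assoc, ← mul_assoc, ← RCLike.ofReal_mul, ← RCLike.ofReal_mul]
    congr 2
    have e5 : ∏ i, w i (knots Y i) =
        if Interlace q ζp ζm X.1 Y.1 then (∏ i, |Y.1 i|) * (1 - q) ^ (n + 1) else 0 := by
      split_ifs with hI
      · rw [← Fin.prod_const, ← Finset.prod_mul_distrib]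
        exact Finset.prod_congr rfl fun i _ => if_pos (hI i)
      · rw [Interlace, not_forall] at hI
        obtain ⟨i, hi⟩ := hI
        exact Finset.prod_eq_zero (Finset.mem_univ i) (if_neg hi)
    rw [e5, linkEntry, abs_vandermonde X.2.1, abs_vandermonde Y.2.1, qPochhammer_self hq1,
      qFactorial_succ]
    split_ifs
    · field_simp
    · simp
  · intro y hy
    have : ∏ i, w i (y i) = 0 := by
      by_contra h0
      have hI : Interlace q ζp ζm X.1 (fun i => (y i : ℝ)) := by
        intro i
        by_contra hi
        exact h0 (Finset.prod_eq_zero (Finset.mem_univ i) (if_neg hi))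
      exact hy ⟨⟨fun i => y i, strictMono_of_interlace X.2.1 hI, fun i => (hI i).1⟩, rfl⟩
    rw [this]
    simp

/-- Existence of the limit at `0` is assumed because `qDeriv` is defined there by `limUnder`, which
is arbitrary when no limit exists. -/
theorem qDeriv_const_mul (hq0 : 0 < q) (hq1 : q < 1) (hζp : 0 < ζp) (hζm : ζm < 0) (c : 𝕜)
    {f : closedLattice q ζp ζm → 𝕜} {d : 𝕜}
    (hd : Tendsto (qDeriv f) (𝓝[≠] origin q ζp ζm) (𝓝 d)) :
    qDeriv (fun t => c * f t) = fun t => c * qDeriv f t := by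
  have hQ : qQuotient (fun t => c * f t) = fun t => c * qQuotient f t := by
    funext t
    rw [qQuotient, qQuotient, ← mul_sub, mul_div_assoc]
  have hd' := hd.congr' (qDeriv_eventuallyEq f)
  funext t
  by_cases ht : (t : ℝ) = 0
  · obtain rfl : t = origin q ζp ζm := Subtype.ext ht
    rw [qDeriv_origin hq0 hq1 hζp hζm hd', qDeriv_origin hq0 hq1 hζp hζm (c := c * d)]
    rw [hQ]
    exact hd'.const_mul c
  · rw [qDeriv_of_ne ht, qDeriv_of_ne ht, hQ]

theorem iterate_qDeriv_pow (hq0 : 0 < q) (hq1 : q < 1) (hζp : 0 < ζp) (hζm : ζm < 0) (n m : ℕ) :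
    (qDeriv^[n] fun t : closedLattice q ζp ζm => (((t : ℝ)) : 𝕜) ^ (m + n)) =
      fun t : closedLattice q ζp ζm =>
        ((qFactorial q (m + n) / qFactorial q m : ℝ) : 𝕜) * (((t : ℝ)) : 𝕜) ^ m := by
  induction n generalizing m with
  | zero =>
    have := (qFactorial_pos hq0 hq1 m).ne'
    funext t
    simp [this]
  | succ n ih =>
    have e : m + (n + 1) = (m + 1) + n := by ring
    have hD := qDeriv_pow (ζp := ζp) (ζm := ζm) (𝕜 := 𝕜) hq0 hq1 hζp hζm m
    have hcont : Continuous (qDeriv fun t : closedLattice q ζp ζm =>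
        (((t : ℝ)) : 𝕜) ^ (m + 1)) := by
      rw [hD]
      fun_prop
    rw [Function.iterate_succ_apply', e, ih (m + 1), qDeriv_const_mul hq0 hq1 hζp hζm _
      ((hcont.tendsto _).mono_left nhdsWithin_le_nhds), hD]
    funext t
    have h1 := (qFactorial_pos hq0 hq1 m).ne'
    have h2 := (qNumber_pos hq0 hq1 m).ne'
    rw [← mul_assoc, ← RCLike.ofReal_mul, qFactorial_succ m]
    congr 2
    field_simp

theorem isClassC_pow (hq0 : 0 < q) (hq1 : q < 1) (hζp : 0 < ζp) (hζm : ζm < 0) (n m : ℕ) :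
    IsClassC n fun t : closedLattice q ζp ζm => (((t : ℝ)) : 𝕜) ^ (m + n) := by
  refine ⟨by fun_prop, fun ℓ _ hℓ => ?_⟩
  have e : m + n = (m + n - ℓ) + ℓ := by omega
  have hcont : Continuous (qDeriv^[ℓ] fun t : closedLattice q ζp ζm =>
      (((t : ℝ)) : 𝕜) ^ (m + n)) := by
    rw [e, iterate_qDeriv_pow hq0 hq1 hζp hζm]
    fun_prop
  exact ⟨_, (hcont.tendsto _).mono_left nhdsWithin_le_nhds⟩

theorem IsClassC.exists_tendsto_qDeriv {n : ℕ} {f : closedLattice q ζp ζm → 𝕜}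
    (hf : IsClassC (n + 1) f) :
    ∃ c : 𝕜, Tendsto (qDeriv f) (𝓝[≠] origin q ζp ζm) (𝓝 c) :=
  hf.2 1 le_rfl (by omega)

theorem continuousAt_qDeriv (hq0 : 0 < q) (hq1 : q < 1) (hζp : 0 < ζp) (hζm : ζm < 0)
    {f : closedLattice q ζp ζm → 𝕜} {c : 𝕜}
    (hc : Tendsto (qDeriv f) (𝓝[≠] origin q ζp ζm) (𝓝 c)) :
    ContinuousAt (qDeriv f) (origin q ζp ζm) := by
  rw [continuousAt_iff_punctured_nhds,
    qDeriv_origin hq0 hq1 hζp hζm (hc.congr' (qDeriv_eventuallyEq f))]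
  exact hc

theorem IsClassC.qDeriv (hq0 : 0 < q) (hq1 : q < 1) (hζp : 0 < ζp) (hζm : ζm < 0) {n : ℕ}
    {f : closedLattice q ζp ζm → 𝕜} (hf : IsClassC (n + 1) f) : IsClassC n (qDeriv f) := by
  obtain ⟨c, hc⟩ := hf.exists_tendsto_qDeriv
  exact ⟨continuousAt_qDeriv hq0 hq1 hζp hζm hc, fun ℓ _ h2 => hf.2 (ℓ + 1) (by omega) (by omega)⟩

theorem IsClassC.continuousAt_iterate_qDeriv (hq0 : 0 < q) (hq1 : q < 1) (hζp : 0 < ζp)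
    (hζm : ζm < 0) {n : ℕ} {f : closedLattice q ζp ζm → 𝕜} (hf : IsClassC n f) :
    ContinuousAt (QBSpline.qDeriv^[n] f) (origin q ζp ζm) := by
  induction n generalizing f with
  | zero => exact hf.1
  | succ n ih => exact ih (hf.qDeriv hq0 hq1 hζp hζm)

/-- The rows of the link matrices sum to one. -/
theorem hasSum_linkEntry (hq0 : 0 < q) (hq1 : q < 1) (hζp : 0 < ζp) (hζm : ζm < 0) {n : ℕ}
    (X : level q ζp ζm (n + 2)) :
    HasSum (fun Y : level q ζp ζm (n + 1) => linkEntry q ζp ζm X.1 Y.1) 1 := by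
  have hcont : Continuous fun t : closedLattice q ζp ζm => (t : ℝ) ^ (n + 1) := by fun_prop
  have hD := qDeriv_pow (𝕜 := ℝ) hq0 hq1 hζp hζm n
  have hcont' : Continuous (qDeriv fun t : closedLattice q ζp ζm => (t : ℝ) ^ (n + 1)) := by
    simp only [RCLike.ofReal_real_eq_id, id] at hD
    rw [hD]
    fun_prop
  -- For `f = t^(n+1)` all divided differences involved are `h_0 = 1`, up to the factor `[n+1]_q`
  -- from `D_q f`.
  have h := hasSum_linkEntry_mul_dividedDifference (𝕜 := ℝ) hq0 hq1 hζp hζm hcont.continuousAt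
    ((hcont'.tendsto _).mono_left nhdsWithin_le_nhds) X
  have hX := dividedDifference_pow (𝕜 := ℝ) (n + 1) 0 (knots X) (knots_injective X)
  have hY := fun Y : level q ζp ζm (n + 1) =>
    dividedDifference_pow (𝕜 := ℝ) n 0 (knots Y) (knots_injective Y)
  simp only [RCLike.ofReal_real_eq_id, id, completeHom_zero, zero_add] at hD h hX hY
  have hq := (qNumber_pos hq0 hq1 n).ne'
  simp only [hD, dividedDifference_const_mul, hX, hY] at h
  have := h.mul_right (qNumber q (n + 1))⁻¹
  simpa [hq] using this

end Link

section Measures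

variable {q ζp ζm : ℝ} {𝕜 : Type} [RCLike 𝕜]

/-! ### Countability and local finiteness of the lattice -/

theorem countable_closedLattice (q ζp ζm : ℝ) : Countable (closedLattice q ζp ζm) := by
  have h : ∀ ζ : ℝ, {t : ℝ | ∃ n : ℤ, t = ζ * q ^ n}.Countable := fun ζ =>
    (Set.countable_range fun n : ℤ => ζ * q ^ n).mono (by rintro _ ⟨n, rfl⟩; exact ⟨n, rfl⟩)
  exact (((h ζp).union (h ζm)).union (Set.countable_singleton 0)).to_subtype

theorem countable_level (q ζp ζm : ℝ) (N : ℕ) : Countable (level q ζp ζm N) := by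
  have := countable_closedLattice q ζp ζm
  refine Function.Injective.countable (f := fun X : level q ζp ζm N => knots X) fun Y Z h => ?_
  exact Subtype.ext (funext fun i => congrArg Subtype.val (congrFun h i))

theorem finite_zpow_mem_Icc (hq0 : 0 < q) (hq1 : q < 1) {ζ ε R : ℝ} (hζ : ζ ≠ 0) (hε : 0 < ε) :
    {n : ℤ | ε ≤ |ζ * q ^ n| ∧ |ζ * q ^ n| ≤ R}.Finite := by
  have hl : Real.log q < 0 := Real.log_neg hq0 hq1
  refine (Set.finite_Icc ⌊(Real.log R - Real.log |ζ|) / Real.log q⌋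
    ⌈(Real.log ε - Real.log |ζ|) / Real.log q⌉).subset ?_
  rintro n ⟨h1, h2⟩
  have hpos : 0 < |ζ * q ^ n| := hε.trans_le h1
  have e : Real.log |ζ * q ^ n| = Real.log |ζ| + n * Real.log q := by
    rw [abs_mul, abs_of_pos (zpow_pos hq0 n), Real.log_mul (abs_pos.2 hζ).ne'
      (zpow_pos hq0 n).ne', Real.log_zpow]
  have h3 := Real.log_le_log hε h1
  have h4 := Real.log_le_log hpos h2
  rw [e] at h3 h4
  constructor
  · have : ((Real.log R - Real.log |ζ|) / Real.log q) ≤ n := by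
      rw [div_le_iff_of_neg hl]; linarith
    exact_mod_cast (Int.floor_le _).trans this
  · have : (n : ℝ) ≤ ((Real.log ε - Real.log |ζ|) / Real.log q) := by
      rw [le_div_iff_of_neg hl]; linarith
    exact_mod_cast this.trans (Int.le_ceil _)

theorem finite_closedLattice_inter (hq0 : 0 < q) (hq1 : q < 1) (hζp : 0 < ζp) (hζm : ζm < 0)
    {ε : ℝ} (hε : 0 < ε) (R : ℝ) :
    (closedLattice q ζp ζm ∩ {t | ε ≤ |t| ∧ |t| ≤ R}).Finite := by
  refine (((finite_zpow_mem_Icc (R := R) hq0 hq1 hζp.ne' hε).image fun n => ζp * q ^ n).union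
    ((finite_zpow_mem_Icc (R := R) hq0 hq1 hζm.ne hε).image fun n => ζm * q ^ n)).subset ?_
  rintro t ⟨(⟨n, rfl⟩ | ⟨n, rfl⟩) | rfl, h⟩
  · exact Or.inl ⟨n, h, rfl⟩
  · exact Or.inr ⟨n, h, rfl⟩
  · simp only [abs_zero, Set.mem_ofPred_eq] at h
    exact absurd h.1 hε.not_ge

/-- The lattice can accumulate only at `0`, which `closedLattice` contains. -/
theorem isClosed_closedLattice (hq0 : 0 < q) (hq1 : q < 1) (hζp : 0 < ζp) (hζm : ζm < 0) :
    IsClosed (closedLattice q ζp ζm) := by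
  refine isClosed_of_closure_subset fun t ht => ?_
  by_cases h0 : t = 0
  · exact Or.inr h0
  have hpos : 0 < |t| := abs_pos.2 h0
  have hfin := finite_closedLattice_inter hq0 hq1 hζp hζm (half_pos hpos) (2 * |t|)
  have hU : {s : ℝ | |t| / 2 ≤ |s| ∧ |s| ≤ 2 * |t|} ∈ 𝓝 t := by
    have h1 : ∀ᶠ s in 𝓝 t, |t| / 2 < |s| :=
      continuous_abs.continuousAt.eventually_const_lt (by linarith)
    have h2 : ∀ᶠ s in 𝓝 t, |s| < 2 * |t| :=
      continuous_abs.continuousAt.eventually_lt_const (by linarith)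
    filter_upwards [h1, h2] with s hs1 hs2 using ⟨hs1.le, hs2.le⟩
  have h : t ∈ closure (closedLattice q ζp ζm ∩ {s : ℝ | |t| / 2 ≤ |s| ∧ |s| ≤ 2 * |t|}) := by
    rw [mem_closure_iff_nhds] at ht ⊢
    intro V hV
    obtain ⟨s, hs, hs'⟩ := ht _ (inter_mem hV hU)
    exact ⟨s, hs.1, hs', hs.2⟩
  rw [hfin.isClosed.closure_eq] at h
  exact h.1

/-- Continuity controls `g` near `0`, and only finitely many points of the bounded region remain. -/
theorem exists_norm_le_of_continuousAt_origin (hq0 : 0 < q) (hq1 : q < 1) (hζp : 0 < ζp)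
    (hζm : ζm < 0) {g : closedLattice q ζp ζm → 𝕜} (hg : ContinuousAt g (origin q ζp ζm)) (R : ℝ) :
    ∃ C, ∀ t : closedLattice q ζp ζm, |(t : ℝ)| ≤ R → ‖g t‖ ≤ C := by
  have h1 : ∀ᶠ t in 𝓝 (origin q ζp ζm), ‖g t‖ < ‖g (origin q ζp ζm)‖ + 1 :=
    hg.norm.eventually_lt_const (by simp)
  obtain ⟨ε, hε, hb⟩ := Metric.eventually_nhds_iff.1 h1
  have hfin : {t : closedLattice q ζp ζm | ε ≤ |(t : ℝ)| ∧ |(t : ℝ)| ≤ R}.Finite := by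
    refine Set.Finite.of_finite_image (f := Subtype.val) ?_ Subtype.val_injective.injOn
    refine (finite_closedLattice_inter hq0 hq1 hζp hζm hε R).subset ?_
    rintro _ ⟨t, ht, rfl⟩
    exact ⟨t.2, ht⟩
  obtain ⟨C, hC⟩ := (hfin.image fun t => ‖g t‖).bddAbove
  refine ⟨max (‖g (origin q ζp ζm)‖ + 1) C, fun t ht => ?_⟩
  by_cases h : ε ≤ |(t : ℝ)|
  · exact (hC ⟨t, ⟨h, ht⟩, rfl⟩).trans (le_max_right _ _)
  · refine (hb ?_).le.trans (le_max_left _ _)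
    rw [Subtype.dist_eq, Real.dist_eq]
    simpa [origin] using not_le.1 h

/-! ### The rows of the link matrices as measures -/

theorem linkMeasure_level_one (X : level q ζp ζm 1) :
    linkMeasure X = Measure.dirac (knots X 0) := by
  classical
  refine Measure.ext fun s hs => ?_
  rw [linkMeasure, Measure.sum_apply _ hs, tsum_eq_single X]
  · simp [linkToOne]
  · intro Z hZ
    simp [linkToOne, hZ.symm]

/-- The matrix product as a mixture of lower rows; this drives the inductions below. -/
theorem linkMeasure_level_succ {n : ℕ} (X : level q ζp ζm (n + 2)) :
    linkMeasure X = Measure.sum fun Y : level q ζp ζm (n + 1) =>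
      ENNReal.ofReal (linkEntry q ζp ζm X.1 Y.1) • linkMeasure Y := by
  refine Measure.ext fun s hs => ?_
  simp only [linkMeasure, Measure.sum_apply _ hs, Measure.smul_apply, smul_eq_mul, linkToOne,
    ← ENNReal.tsum_mul_right, ← ENNReal.tsum_mul_left]
  rw [ENNReal.tsum_comm]
  simp only [mul_assoc]

theorem isProbabilityMeasure_linkMeasure (hq0 : 0 < q) (hq1 : q < 1) (hζp : 0 < ζp) (hζm : ζm < 0)
    {n : ℕ} (X : level q ζp ζm (n + 1)) : IsProbabilityMeasure (linkMeasure X) := by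
  induction n with
  | zero =>
    rw [linkMeasure_level_one]
    infer_instance
  | succ n ih =>
    have hs := hasSum_linkEntry hq0 hq1 hζp hζm X
    refine ⟨?_⟩
    rw [linkMeasure_level_succ, Measure.sum_apply _ MeasurableSet.univ]
    have : ∀ Y : level q ζp ζm (n + 1),
        (ENNReal.ofReal (linkEntry q ζp ζm X.1 Y.1) • linkMeasure Y) Set.univ =
          ENNReal.ofReal (linkEntry q ζp ζm X.1 Y.1) := by
      intro Y
      have := ih Y
      simp
    simp only [this]
    rw [← ENNReal.ofReal_tsum_of_nonneg (fun Y => linkEntry_nonneg hq0 hq1 _ _) hs.summable,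
      hs.tsum_eq, ENNReal.ofReal_one]

theorem ae_linkMeasure_mem_Icc {n : ℕ} (X : level q ζp ζm (n + 1)) :
    ∀ᵐ t : closedLattice q ζp ζm ∂linkMeasure X,
      (t : ℝ) ∈ Set.Icc (X.1 0) (X.1 (Fin.last n)) := by
  induction n with
  | zero =>
    rw [linkMeasure_level_one, ae_dirac_eq]
    exact ⟨le_rfl, le_rfl⟩
  | succ n ih =>
    have := countable_level q ζp ζm (n + 1)
    rw [linkMeasure_level_succ, Measure.ae_sum_iff]
    intro Y
    by_cases hI : Interlace q ζp ζm X.1 Y.1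
    · refine Measure.ae_smul_measure ?_ _
      filter_upwards [ih Y] with t ht
      have h0 := (hI 0).2
      have h1 := (hI (Fin.last n)).2
      simp only [Fin.castSucc_zero, Fin.succ_last] at h0 h1
      constructor
      · refine le_trans ?_ ht.1
        rcases h0 with ⟨_, _, _⟩ | ⟨_, _, _, _⟩ | ⟨_, _, _⟩ <;> linarith
      · refine ht.2.trans ?_
        rcases h1 with ⟨_, _, _⟩ | ⟨_, _, _, _⟩ | ⟨_, _, _⟩ <;> linarith
    · rw [linkEntry, if_neg hI]
      simp

theorem integrable_linkMeasure (hq0 : 0 < q) (hq1 : q < 1) (hζp : 0 < ζp) (hζm : ζm < 0)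
    {g : closedLattice q ζp ζm → 𝕜} (hg : ContinuousAt g (origin q ζp ζm)) {n : ℕ}
    (X : level q ζp ζm (n + 1)) : Integrable g (linkMeasure X) := by
  have := isProbabilityMeasure_linkMeasure hq0 hq1 hζp hζm X
  have := countable_closedLattice q ζp ζm
  obtain ⟨C, hC⟩ := exists_norm_le_of_continuousAt_origin hq0 hq1 hζp hζm hg
    (max |X.1 0| |X.1 (Fin.last n)|)
  refine Integrable.of_bound (measurable_of_countable g).aestronglyMeasurable C ?_
  filter_upwards [ae_linkMeasure_mem_Icc X] with t ht
  exact hC t (abs_le_max_abs_abs ht.1 ht.2)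

/-- Induction on `n`: the mixture reduces to rows one level down, with `D_q f` in place of `f`, and
the one-step identity sums the resulting divided differences. -/
theorem integral_iterate_qDeriv (hq0 : 0 < q) (hq1 : q < 1) (hζp : 0 < ζp) (hζm : ζm < 0) {n : ℕ}
    {f : closedLattice q ζp ζm → 𝕜} (hf : IsClassC n f) (X : level q ζp ζm (n + 1)) :
    ∫ t, (qDeriv^[n] f) t ∂linkMeasure X =
      ((qFactorial q n : ℝ) : 𝕜) * dividedDifference f (n + 1) (knots X) := by
  induction n generalizing f with
  | zero =>
    rw [linkMeasure_level_one]
    simp [dividedDifference, qFactorial_zero]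
  | succ n ih =>
    obtain ⟨c, hc⟩ := hf.exists_tendsto_qDeriv
    have hint : Integrable (qDeriv^[n + 1] f) (linkMeasure X) :=
      integrable_linkMeasure hq0 hq1 hζp hζm (hf.continuousAt_iterate_qDeriv hq0 hq1 hζp hζm) X
    have hs := (hasSum_linkEntry_mul_dividedDifference hq0 hq1 hζp hζm hf.1 hc X).mul_left
      ((qFactorial q n : ℝ) : 𝕜)
    have hs' : HasSum (fun Y : level q ζp ζm (n + 1) => ∫ t, (qDeriv^[n + 1] f) t
        ∂(ENNReal.ofReal (linkEntry q ζp ζm X.1 Y.1) • linkMeasure Y))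
        (∫ t, (qDeriv^[n + 1] f) t ∂linkMeasure X) := by
      rw [linkMeasure_level_succ X] at hint ⊢
      exact hasSum_integral_measure hint
    have e : ∀ Y : level q ζp ζm (n + 1), ∫ t, (qDeriv^[n + 1] f) t
        ∂(ENNReal.ofReal (linkEntry q ζp ζm X.1 Y.1) • linkMeasure Y) =
        ((qFactorial q n : ℝ) : 𝕜) * (((linkEntry q ζp ζm X.1 Y.1 : ℝ) : 𝕜) *
          dividedDifference (qDeriv f) (n + 1) (knots Y)) := by
      intro Y
      rw [integral_smul_measure, ENNReal.toReal_ofReal (linkEntry_nonneg hq0 hq1 _ _),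
        Function.iterate_succ, Function.comp_apply, ih (hf.qDeriv hq0 hq1 hζp hζm) Y,
        RCLike.real_smul_eq_coe_mul]
      ring
    simp only [e] at hs'
    rw [hs'.unique hs, qFactorial_succ, RCLike.ofReal_mul, mul_assoc]

theorem hasSplineMoments_linkMeasure (hq0 : 0 < q) (hq1 : q < 1) (hζp : 0 < ζp) (hζm : ζm < 0)
    {n : ℕ} (X : level q ζp ζm (n + 1)) : HasSplineMoments X.1 (linkMeasure X) := by
  intro m
  refine ⟨integrable_linkMeasure hq0 hq1 hζp hζm (by fun_prop) X, ?_⟩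
  have h := integral_iterate_qDeriv (𝕜 := ℝ) hq0 hq1 hζp hζm
    (isClassC_pow hq0 hq1 hζp hζm n m) X
  have h1 := (qFactorial_pos hq0 hq1 m).ne'
  have h2 := (qFactorial_pos hq0 hq1 (m + n)).ne'
  rw [iterate_qDeriv_pow hq0 hq1 hζp hζm, dividedDifference_pow _ _ _ (knots_injective X),
    integral_const_mul] at h
  simp only [RCLike.ofReal_real_eq_id, id] at h
  have e : m + (n + 1) - 1 = m + n := by omega
  change _ = qFactorial q m * qFactorial q n / _ * completeHom m (fun i => (knots X i : ℝ))
  rw [e]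
  field_simp at h ⊢
  linarith

end Measures

/-! ### Moments and weak convergence on a closed set of reals -/

section Moments

variable {s : Set ℝ}

/-- Tietze extension from the closed set `s`, then Weierstrass on `[-R, R]`. -/
theorem exists_polynomial_near_boundedContinuous (hs : IsClosed s)
    (φ : BoundedContinuousFunction s ℝ) (R : ℝ) {ε : ℝ} (hε : 0 < ε) :
    ∃ p : Polynomial ℝ, ∀ t : s, |(t : ℝ)| ≤ R → |p.eval (t : ℝ) - φ t| < ε := by
  obtain ⟨g, hg⟩ := ContinuousMap.exists_extension' hs.isClosedEmbedding_subtypeVal φ.toContinuousMap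
  obtain ⟨p, hp⟩ := exists_polynomial_near_of_continuousOn (-R) R g g.continuous.continuousOn ε hε
  refine ⟨p, fun t ht => ?_⟩
  have : g (t : ℝ) = φ t := congrFun hg t
  rw [← this]
  exact hp t (abs_le.1 ht)

theorem integrable_of_ae_abs_le {ν : Measure s} [IsFiniteMeasure ν] {R : ℝ}
    (h : ∀ᵐ t : s ∂ν, |(t : ℝ)| ≤ R) {g : ℝ → ℝ} (hg : Continuous g) :
    Integrable (fun t : s => g t) ν := by
  obtain ⟨C, hC⟩ := (isCompact_Icc (a := -R) (b := R)).exists_bound_of_continuousOn hg.continuousOn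
  refine Integrable.of_bound (hg.comp continuous_subtype_val).aestronglyMeasurable C ?_
  filter_upwards [h] with t ht using hC t (abs_le.1 ht)

theorem abs_integral_sub_le {ν : Measure s} [IsProbabilityMeasure ν] {R ε : ℝ}
    (h : ∀ᵐ t : s ∂ν, |(t : ℝ)| ≤ R) {φ : BoundedContinuousFunction s ℝ} {p : Polynomial ℝ}
    (hp : ∀ t : s, |(t : ℝ)| ≤ R → |p.eval (t : ℝ) - φ t| < ε) :
    |∫ t : s, p.eval (t : ℝ) ∂ν - ∫ t, φ t ∂ν| ≤ ε := by
  rw [← integral_sub (integrable_of_ae_abs_le h p.continuous) (φ.integrable ν)]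
  have h1 : ∀ᵐ t : s ∂ν, ‖p.eval (t : ℝ) - φ t‖ ≤ ε := by
    filter_upwards [h] with t ht using (hp t ht).le
  simpa using norm_integral_le_of_norm_le_const h1

/-- For probability measures with a common compact support, convergence of the moments implies
weak convergence. -/
theorem tendsto_of_tendsto_moments (hs : IsClosed s) {ι : Type*} {l : Filter ι}
    {μ : ι → ProbabilityMeasure s} {ν : ProbabilityMeasure s} {R : ℝ}
    (hμ : ∀ᶠ i in l, ∀ᵐ t : s ∂(μ i : Measure s), |(t : ℝ)| ≤ R)
    (hν : ∀ᵐ t : s ∂(ν : Measure s), |(t : ℝ)| ≤ R)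
    (hm : ∀ m : ℕ, Tendsto (fun i => ∫ t : s, (t : ℝ) ^ m ∂(μ i : Measure s)) l
      (𝓝 (∫ t : s, (t : ℝ) ^ m ∂(ν : Measure s)))) :
    Tendsto μ l (𝓝 ν) := by
  rw [ProbabilityMeasure.tendsto_iff_forall_integral_tendsto]
  intro φ
  rw [Metric.tendsto_nhds]
  intro ε hε
  obtain ⟨p, hp⟩ := exists_polynomial_near_boundedContinuous hs φ R (ε := ε / 3) (by linarith)
  have hpoly : ∀ ρ : ProbabilityMeasure s, (∀ᵐ t : s ∂(ρ : Measure s), |(t : ℝ)| ≤ R) →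
      ∫ t : s, p.eval (t : ℝ) ∂(ρ : Measure s) =
        ∑ m ∈ Finset.range (p.natDegree + 1),
          p.coeff m * ∫ t : s, (t : ℝ) ^ m ∂(ρ : Measure s) := by
    intro ρ hρ
    simp only [Polynomial.eval_eq_sum_range]
    rw [integral_finsetSum]
    · simp only [integral_const_mul]
    · exact fun m _ => (integrable_of_ae_abs_le hρ (continuous_pow m)).const_mul _
  have hlim : Tendsto (fun i => ∑ m ∈ Finset.range (p.natDegree + 1),
      p.coeff m * ∫ t : s, (t : ℝ) ^ m ∂(μ i : Measure s)) l
      (𝓝 (∫ t : s, p.eval (t : ℝ) ∂(ν : Measure s))) := by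
    rw [hpoly ν hν]
    exact tendsto_finsetSum _ fun m _ => (hm m).const_mul _
  filter_upwards [hμ, Metric.tendsto_nhds.1 hlim (ε / 3) (by linarith)] with i hi hi'
  rw [← hpoly _ hi, Real.dist_eq] at hi'
  rw [Real.dist_eq]
  have h1 := abs_integral_sub_le hi hp
  have h2 := abs_integral_sub_le hν hp
  rw [abs_lt] at hi' ⊢
  rw [abs_le] at h1 h2
  constructor <;> linarith

/-- Markov's inequality for `t^(2m)` bounds the mass of `|t| ≥ r` by `(R/r)^(2m)`, which tends to
`0` for `r > R`. Thus uniqueness needs no support assumption on the competing measure. -/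
theorem ae_abs_le_of_moments_le {ν : Measure s} [IsProbabilityMeasure ν] {R : ℝ} (hR : 0 ≤ R)
    (hint : ∀ m : ℕ, Integrable (fun t : s => (t : ℝ) ^ m) ν)
    (h : ∀ m : ℕ, ∫ t : s, (t : ℝ) ^ (2 * m) ∂ν ≤ R ^ (2 * m)) :
    ∀ᵐ t : s ∂ν, |(t : ℝ)| ≤ R := by
  have key : ∀ r : ℝ, R < r → ∀ᵐ t : s ∂ν, |(t : ℝ)| < r := by
    intro r hr
    have hr0 : 0 < r := hR.trans_lt hr
    have hbound : ∀ m : ℕ, ν.real {t : s | r ≤ |(t : ℝ)|} ≤ ((R / r) ^ 2) ^ m := by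
      intro m
      have h1 := mul_meas_ge_le_integral_of_nonneg (μ := ν) (f := fun t : s => (t : ℝ) ^ (2 * m))
        (ae_of_all _ fun t => (even_two_mul m).pow_nonneg _) (hint _) (r ^ (2 * m))
      have h2 : ν.real {t : s | r ≤ |(t : ℝ)|} ≤
          ν.real {t : s | r ^ (2 * m) ≤ (t : ℝ) ^ (2 * m)} := by
        refine measureReal_mono fun t ht => ?_
        have := pow_le_pow_left₀ hr0.le ht (2 * m)
        rwa [(even_two_mul m).pow_abs] at this
      have hp : 0 < r ^ (2 * m) := pow_pos hr0 _
      rw [← pow_mul, div_pow, le_div_iff₀ hp, mul_comm]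
      exact (mul_le_mul_of_nonneg_left h2 hp.le).trans (h1.trans (h m))
    have hlt : (R / r) ^ 2 < 1 := by
      have h0 : 0 ≤ R / r := by positivity
      have h1 : R / r < 1 := (div_lt_one hr0).2 hr
      nlinarith
    have hzero : ν.real {t : s | r ≤ |(t : ℝ)|} ≤ 0 :=
      ge_of_tendsto' (tendsto_pow_atTop_nhds_zero_of_lt_one (sq_nonneg _) hlt) hbound
    have : ν {t : s | r ≤ |(t : ℝ)|} = 0 :=
      (measureReal_eq_zero_iff).1 (le_antisymm hzero measureReal_nonneg)
    rw [ae_iff]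
    simpa only [not_lt] using this
  have hall : ∀ᵐ t : s ∂ν, ∀ k : ℕ, |(t : ℝ)| < R + 1 / ((k : ℝ) + 1) :=
    ae_all_iff.2 fun k => key _ (by simp; positivity)
  filter_upwards [hall] with t ht
  have := (tendsto_one_div_add_atTop_nhds_zero_nat (𝕜 := ℝ)).const_add R
  rw [add_zero] at this
  exact ge_of_tendsto' this fun k => (ht k).le

/-- A compactly supported probability measure is determined by its moments, among all probability
measures. -/
theorem eq_of_moments_eq (hs : IsClosed s) {μ ν : ProbabilityMeasure s} {R : ℝ}
    (hμ : ∀ᵐ t : s ∂(μ : Measure s), |(t : ℝ)| ≤ R)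
    (hint : ∀ m : ℕ, Integrable (fun t : s => (t : ℝ) ^ m) (ν : Measure s))
    (h : ∀ m : ℕ, ∫ t : s, (t : ℝ) ^ m ∂(ν : Measure s) = ∫ t : s, (t : ℝ) ^ m ∂(μ : Measure s)) :
    ν = μ := by
  have hR : 0 ≤ R := by
    obtain ⟨t, ht⟩ := hμ.exists
    exact (abs_nonneg _).trans ht
  have hν : ∀ᵐ t : s ∂(ν : Measure s), |(t : ℝ)| ≤ R := by
    refine ae_abs_le_of_moments_le hR hint fun m => ?_
    rw [h]
    have h1 : ∀ᵐ t : s ∂(μ : Measure s), ‖(t : ℝ) ^ (2 * m)‖ ≤ R ^ (2 * m) := by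
      filter_upwards [hμ] with t ht
      rw [norm_pow]
      exact pow_le_pow_left₀ (norm_nonneg _) ht _
    refine (le_abs_self _).trans ?_
    simpa using norm_integral_le_of_norm_le_const h1
  -- The constant sequence `ν` converges weakly to `μ`, and weak limits are unique.
  have h1 : Tendsto (fun _ : ℕ => ν) atTop (𝓝 μ) :=
    tendsto_of_tendsto_moments hs (Eventually.of_forall fun _ => hν) hμ fun m => by
      rw [h]
      exact tendsto_const_nhds
  exact tendsto_nhds_unique tendsto_const_nhds h1

theorem ae_mem_of_tendsto {ι : Type*} {l : Filter ι} [l.NeBot] {μ : ι → ProbabilityMeasure s}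
    {ν : ProbabilityMeasure s} (h : Tendsto μ l (𝓝 ν)) {F : Set s} (hF : IsClosed F)
    (hμ : ∀ᶠ i in l, ∀ᵐ t ∂(μ i : Measure s), t ∈ F) : ∀ᵐ t ∂(ν : Measure s), t ∈ F := by
  have h1 := ProbabilityMeasure.le_liminf_measure_open_of_tendsto h hF.isOpen_compl
  have h2 : (fun i => (μ i : Measure s) Fᶜ) =ᶠ[l] fun _ => 0 := by
    filter_upwards [hμ] with i hi using hi
  rw [liminf_congr h2, liminf_const] at h1
  exact le_antisymm h1 bot_le

theorem tendsto_moment_of_tendsto {ι : Type*} {l : Filter ι}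
    {μ : ι → ProbabilityMeasure s} {ν : ProbabilityMeasure s} (h : Tendsto μ l (𝓝 ν)) {R : ℝ}
    (hμ : ∀ᶠ i in l, ∀ᵐ t : s ∂(μ i : Measure s), |(t : ℝ)| ≤ R)
    (hν : ∀ᵐ t : s ∂(ν : Measure s), |(t : ℝ)| ≤ R) (m : ℕ) :
    Tendsto (fun i => ∫ t : s, (t : ℝ) ^ m ∂(μ i : Measure s)) l
      (𝓝 (∫ t : s, (t : ℝ) ^ m ∂(ν : Measure s))) := by
  -- Powers are unbounded, so the test function is the power of the truncated variable, equal to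
  -- `t^m` on the supports.
  set φ : BoundedContinuousFunction s ℝ := BoundedContinuousFunction.ofNormedAddCommGroup
    (fun t : s => (max (-|R|) (min (t : ℝ) |R|)) ^ m) (by fun_prop) (|R| ^ m) (fun t => by
      rw [norm_pow]
      refine pow_le_pow_left₀ (norm_nonneg _) ?_ _
      rw [Real.norm_eq_abs, abs_le]
      exact ⟨le_max_left _ _, max_le (neg_le_self (abs_nonneg R)) (min_le_right _ _)⟩) with hφ
  have e : ∀ ρ : ProbabilityMeasure s, (∀ᵐ t : s ∂(ρ : Measure s), |(t : ℝ)| ≤ R) →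
      ∫ t, φ t ∂(ρ : Measure s) = ∫ t : s, (t : ℝ) ^ m ∂(ρ : Measure s) := by
    intro ρ hρ
    refine integral_congr_ae ?_
    filter_upwards [hρ] with t ht
    have h1 := abs_le.1 (ht.trans (le_abs_self R))
    simp only [hφ, BoundedContinuousFunction.coe_ofNormedAddCommGroup]
    rw [min_eq_left h1.2, max_eq_right h1.1]
  have h1 := ProbabilityMeasure.tendsto_iff_forall_integral_tendsto.1 h φ
  rw [e ν hν] at h1
  refine h1.congr' ?_
  filter_upwards [hμ] with i hi using e _ hi

/-- Prokhorov's criterion with one compact set and zero mass allowed outside it. -/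
theorem isCompact_setOf_ae_abs_le (hs : IsClosed s) (R : ℝ) :
    IsCompact {μ : ProbabilityMeasure s | ∀ᵐ t : s ∂(μ : Measure s), |(t : ℝ)| ≤ R} := by
  have hK : IsCompact {t : s | |(t : ℝ)| ≤ R} := by
    have := hs.isClosedEmbedding_subtypeVal.isCompact_preimage (isCompact_Icc (a := -R) (b := R))
    simpa only [Set.preimage, Set.mem_Icc, ← abs_le] using this
  have h := isCompact_setOfPred_probabilityMeasure_mass_eq_compl_isCompact_le (u := fun _ => 0)
    (K := fun _ => {t : s | |(t : ℝ)| ≤ R}) tendsto_const_nhds (fun _ => hK)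
    (Or.inr monotone_const)
  convert h using 1
  ext μ
  simp only [Set.mem_ofPred_eq, nonpos_iff_eq_zero, forall_const]
  rw [ae_iff, ProbabilityMeasure.null_iff_toMeasure_null]
  rfl

end Moments

/-! ### The extension to the closure -/

section Extension

variable {q ζp ζm : ℝ}

theorem eventually_Icc_bounds {n : ℕ} (X : Fin (n + 1) → ℝ) {ε : ℝ} (hε : 0 < ε) :
    ∀ᶠ Y : Fin (n + 1) → ℝ in 𝓝 X,
      Set.Icc (Y 0) (Y (Fin.last n)) ⊆ Set.Icc (X 0 - ε) (X (Fin.last n) + ε) := by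
  have h1 : ∀ᶠ Y : Fin (n + 1) → ℝ in 𝓝 X, X 0 - ε < Y 0 :=
    (continuous_apply (0 : Fin (n + 1))).continuousAt.eventually_const_lt (by linarith)
  have h2 : ∀ᶠ Y : Fin (n + 1) → ℝ in 𝓝 X, Y (Fin.last n) < X (Fin.last n) + ε :=
    (continuous_apply (Fin.last n)).continuousAt.eventually_lt_const (by linarith)
  filter_upwards [h1, h2] with Y hY1 hY2 using Set.Icc_subset_Icc hY1.le hY2.le

/-- A common bound for the points of `[x₁ - 1, x_N + 1]`. -/
theorem abs_le_of_mem_Icc_bounds {a b t : ℝ} (ht : t ∈ Set.Icc (a - 1) (b + 1)) :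
    |t| ≤ max |a - 1| |b + 1| :=
  abs_le_max_abs_abs ht.1 ht.2

theorem exists_hasSplineMoments (hq0 : 0 < q) (hq1 : q < 1) (hζp : 0 < ζp) (hζm : ζm < 0) {n : ℕ}
    (X : closedLevel q ζp ζm (n + 1)) :
    ∃ μ : ProbabilityMeasure (closedLattice q ζp ζm),
      HasSplineMoments X.1 (μ : Measure (closedLattice q ζp ζm)) ∧
      ∀ᵐ t : closedLattice q ζp ζm ∂(μ : Measure (closedLattice q ζp ζm)),
        (t : ℝ) ∈ Set.Icc (X.1 0) (X.1 (Fin.last n)) := by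
  have hcl := isClosed_closedLattice hq0 hq1 hζp hζm
  have hne : (comap (Subtype.val : level q ζp ζm (n + 1) → _) (𝓝 X.1)).NeBot :=
    mem_closure_iff_comap_neBot.1 X.2
  -- An ultrafilter of configurations tending to `X`: compactness then gives a limit of the rows
  -- without extracting a subsequence.
  set u := Ultrafilter.of (comap (Subtype.val : level q ζp ζm (n + 1) → _) (𝓝 X.1)) with hu
  have hlim : Tendsto (Subtype.val : level q ζp ζm (n + 1) → _) u (𝓝 X.1) :=
    tendsto_comap.mono_left (Ultrafilter.of_le _)
  set P : level q ζp ζm (n + 1) → ProbabilityMeasure (closedLattice q ζp ζm) := fun Y =>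
    ⟨linkMeasure Y, isProbabilityMeasure_linkMeasure hq0 hq1 hζp hζm Y⟩ with hP
  have hPs : ∀ ε > 0, ∀ᶠ Y in (u : Filter (level q ζp ζm (n + 1))),
      ∀ᵐ t : closedLattice q ζp ζm ∂(P Y : Measure (closedLattice q ζp ζm)),
        (t : ℝ) ∈ Set.Icc (X.1 0 - ε) (X.1 (Fin.last n) + ε) := by
    intro ε hε
    filter_upwards [hlim.eventually (eventually_Icc_bounds X.1 hε)] with Y hY
    filter_upwards [ae_linkMeasure_mem_Icc Y] with t ht using hY ht
  set R := max |X.1 0 - 1| |X.1 (Fin.last n) + 1|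
  have hPR : ∀ᶠ Y in (u : Filter (level q ζp ζm (n + 1))),
      ∀ᵐ t : closedLattice q ζp ζm ∂(P Y : Measure (closedLattice q ζp ζm)), |(t : ℝ)| ≤ R := by
    filter_upwards [hPs 1 one_pos] with Y hY
    filter_upwards [hY] with t ht using abs_le_of_mem_Icc_bounds ht
  obtain ⟨μ, hμR, hμ⟩ := (isCompact_setOf_ae_abs_le hcl R).ultrafilter_le_nhds (u.map P)
    (le_principal_iff.2 hPR)
  have hμ : Tendsto P u (𝓝 μ) := hμ
  refine ⟨μ, fun m => ⟨integrable_of_ae_abs_le hμR (continuous_pow m), ?_⟩, ?_⟩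
  · refine tendsto_nhds_unique (tendsto_moment_of_tendsto hμ hPR hμR m) ?_
    have h1 := ((continuous_completeHom m (n + 1)).tendsto X.1).comp hlim
    refine (h1.const_mul (qFactorial q m * qFactorial q (n + 1 - 1) /
      qFactorial q (m + (n + 1) - 1))).congr fun Y => ?_
    exact (hasSplineMoments_linkMeasure hq0 hq1 hζp hζm Y m).2.symm
  · have hε : ∀ ε > 0, ∀ᵐ t : closedLattice q ζp ζm ∂(μ : Measure (closedLattice q ζp ζm)),
        (t : ℝ) ∈ Set.Icc (X.1 0 - ε) (X.1 (Fin.last n) + ε) := fun ε hε =>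
      ae_mem_of_tendsto hμ (F := Subtype.val ⁻¹' Set.Icc (X.1 0 - ε) (X.1 (Fin.last n) + ε))
        (isClosed_Icc.preimage continuous_subtype_val) (hPs ε hε)
    -- Countably many margins `1/(k+1)` suffice to shrink the support to `[x₁, x_N]`.
    have hall : ∀ᵐ t : closedLattice q ζp ζm ∂(μ : Measure (closedLattice q ζp ζm)), ∀ k : ℕ,
        (t : ℝ) ∈ Set.Icc (X.1 0 - 1 / ((k : ℝ) + 1)) (X.1 (Fin.last n) + 1 / ((k : ℝ) + 1)) :=
      ae_all_iff.2 fun k => hε _ (by positivity)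
    filter_upwards [hall] with t ht
    have hz := tendsto_one_div_add_atTop_nhds_zero_nat (𝕜 := ℝ)
    constructor
    · have := hz.const_sub (X.1 0)
      rw [sub_zero] at this
      exact le_of_tendsto' this fun k => (ht k).1
    · have := hz.const_add (X.1 (Fin.last n))
      rw [add_zero] at this
      exact ge_of_tendsto' this fun k => (ht k).2

theorem denseRange_levelIncl (q ζp ζm : ℝ) (N : ℕ) :
    DenseRange (levelIncl : level q ζp ζm N → closedLevel q ζp ζm N) :=
  (denseRange_inclusion_iff subset_closure).2 subset_rfl

end Extension

end QBSpline

/-! ### Assembly of the theorem. -/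

theorem theorem7 (q ζp ζm : ℝ) (hq0 : 0 < q) (hq1 : q < 1) (hζp : 0 < ζp) (hζm : ζm < 0)
    (N : ℕ) (hN : 1 ≤ N) :
    -- the extension of `Λ^N_1` to the closure of `G_N`: it exists and is unique
    ∃ Λ : closedLevel q ζp ζm N → ProbabilityMeasure (closedLattice q ζp ζm),
      IsExtendedLink Λ ∧
      (∀ Λ' : closedLevel q ζp ζm N → ProbabilityMeasure (closedLattice q ζp ζm),
        IsExtendedLink Λ' → Λ' = Λ) ∧
      -- the `q`-B-splines
      ∃ B : closedLevel q ζp ζm N → ProbabilityMeasure (closedLattice q ζp ζm),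
        -- (i)
        (∀ X : closedLevel q ζp ζm N,
          HasSplineMoments X.1 (B X : Measure (closedLattice q ζp ζm)) ∧
          (∀ ν : ProbabilityMeasure (closedLattice q ζp ζm),
            HasSplineMoments X.1 (ν : Measure (closedLattice q ζp ζm)) → ν = B X) ∧
          (B X : Measure (closedLattice q ζp ζm)).support ⊆
            {t | (t : ℝ) ∈ convexHull ℝ (Set.range X.1)} ∧
          B X = Λ X) ∧
        -- (ii)
        (∀ (𝕜 : Type) [RCLike 𝕜] (f : closedLattice q ζp ζm → 𝕜), IsClassC (N - 1) f →
          ∀ X : level q ζp ζm N,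
            Integrable (qDeriv^[N - 1] f)
              (B (levelIncl X) : Measure (closedLattice q ζp ζm)) ∧
            dividedDifference f N (knots X) =
              ((1 / qFactorial q (N - 1) : ℝ) : 𝕜) *
                ∫ t, (qDeriv^[N - 1] f) t
                  ∂(B (levelIncl X) : Measure (closedLattice q ζp ζm))) := by
  obtain ⟨n, rfl⟩ : ∃ n, N = n + 1 := ⟨N - 1, by omega⟩
  have hcl := isClosed_closedLattice hq0 hq1 hζp hζm
  choose B hBm hBs using
    fun X : closedLevel q ζp ζm (n + 1) => exists_hasSplineMoments hq0 hq1 hζp hζm X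
  have huniq : ∀ (X : closedLevel q ζp ζm (n + 1)) (ν : ProbabilityMeasure (closedLattice q ζp ζm)),
      HasSplineMoments X.1 (ν : Measure (closedLattice q ζp ζm)) → ν = B X := by
    intro X ν hν
    refine eq_of_moments_eq hcl (R := max |X.1 0| |X.1 (Fin.last n)|) ?_ (fun m => (hν m).1)
      fun m => by rw [(hν m).2, (hBm X m).2]
    filter_upwards [hBs X] with t ht using abs_le_max_abs_abs ht.1 ht.2
  have hlink : ∀ X : level q ζp ζm (n + 1),
      (B (levelIncl X) : Measure (closedLattice q ζp ζm)) = linkMeasure X := by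
    intro X
    have h := huniq (levelIncl X)
      ⟨linkMeasure X, isProbabilityMeasure_linkMeasure hq0 hq1 hζp hζm X⟩
      (hasSplineMoments_linkMeasure hq0 hq1 hζp hζm X)
    rw [← h]
    rfl
  have hcont : Continuous B := by
    refine continuous_iff_continuousAt.2 fun X => ?_
    refine tendsto_of_tendsto_moments hcl (R := max |X.1 0 - 1| |X.1 (Fin.last n) + 1|) ?_ ?_ ?_
    · have := (continuous_subtype_val.tendsto X).eventually (eventually_Icc_bounds X.1 one_pos)
      filter_upwards [this] with Y hY
      filter_upwards [hBs Y] with t ht using abs_le_of_mem_Icc_bounds (hY ht)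
    · filter_upwards [hBs X] with t ht
      exact abs_le_of_mem_Icc_bounds ⟨by linarith [ht.1], by linarith [ht.2]⟩
    · intro m
      simp only [fun X => (hBm X m).2]
      exact (((continuous_completeHom m (n + 1)).comp continuous_subtype_val).tendsto X).const_mul _
  -- The same map `B` serves as the extended link and as the spline, so their equality is `rfl`.
  refine ⟨B, ⟨hcont, hlink⟩, ?_, B, fun X => ⟨hBm X, huniq X, ?_, rfl⟩, ?_⟩
  · intro Λ' hΛ'
    refine (denseRange_levelIncl q ζp ζm (n + 1)).equalizer hΛ'.1 hcont (funext fun X => ?_)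
    exact Subtype.ext ((hΛ'.2 X).trans (hlink X).symm)
  · refine Measure.support_subset_of_isClosed
      (t := Subtype.val ⁻¹' Set.Icc (X.1 0) (X.1 (Fin.last n)))
      (isClosed_Icc.preimage continuous_subtype_val) (hBs X) |>.trans fun t ht => ?_
    exact segment_subset_convexHull (Set.mem_range_self _) (Set.mem_range_self _)
      (Icc_subset_segment ht)
  · intro 𝕜 _ f hf X
    rw [hlink X]
    have hf : IsClassC n f := hf
    refine ⟨integrable_linkMeasure hq0 hq1 hζp hζm
      (hf.continuousAt_iterate_qDeriv hq0 hq1 hζp hζm) X, ?_⟩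
    have h := integral_iterate_qDeriv hq0 hq1 hζp hζm hf X
    have h0 : ((qFactorial q n : ℝ) : 𝕜) ≠ 0 :=
      RCLike.ofReal_ne_zero.2 (qFactorial_pos hq0 hq1 n).ne'
    simp only [Nat.add_sub_cancel]
    rw [h, ← mul_assoc, RCLike.ofReal_div, RCLike.ofReal_one, one_div, inv_mul_cancel₀ h0, one_mul]
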